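/- **Setting.** Let $\mathcal N$ (players) and $\mathcal M$ (items) be finite sets with $|\mathcal N|=|\mathcal M|=n$. A preference profile $\sigma$ gives each player $i$ a total order on $\mathcal M$; $O_i(k)$ denotes its $k$-th favorite item. An assignment is a bijection from players to items, identified with its permutation matrix; a mechanism maps each profile to a distribution on assignments, which induces the matrix $P$ whose entry $P(i,j)$ is the probability that $i$ receives $j$. For vectors $p,q$ indexed by the items write $p\succeq_i q$ if $\sum_{k\le \ell}p(O_i(k))\ge\sum_{k\le \ell}q(O_i(k))$ for all $1\le\ell\le n$. **The OnlinePSVar protocol.** The profile $\sigma$ is declared beforehand. Each item is one unit of a divisible good, and each player $i$ has a consumption rate $s_i$, initially $1$. While some rate is positive, every player with positive rate consumes, at its rate, its favorite item among those not yet totally consumed. When an item $j$ is totally consumed, by the set $\widehat{\mathcal N}$ of players with fractions $(p_i)_{i\in\widehat{\mathcal N}}$, these players run, in zero time, a tournament (all tournaments due at the same moment are run in parallel) along a fixed binary tree whose leaves are the players of $\widehat{\mathcal N}$. At each inner node the winners of the two subtrees play a duel, which the first should win with probability $k_1/k$ (in lowest terms), the sum of the $p_i$ in its subtree divided by the sum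 in both. Each of the two samples a uniform element of $\mathbb Z_k$ and broadcasts an ideal (perfectly hiding, perfectly binding, non-malleable) commitment to it; then both open. The first wins if the sum of the two elements lies in $\{0,\dots,k_1-1\}$, otherwise the second. A player that does not open its commitment to an element of $\mathbb Z_k$ is identified as corrupted and loses the duel (if both are, the first wins by default). The winner $\hat\imath$ of the tournament receives $j$. Each other $i\in\widehat{\mathcal N}$ that was not identified as corrupted increases its rate by $s_{\hat\imath}\cdot p_i/\sum_{k\in\widehat{\mathcal N}\setminus\{\hat\imath\}}p_k$, and the rates of all other players of $\widehat{\mathcal N}$ become $0$. Items left at the end are given to players without an item by a fixed rule. The trees and this rule are arbitrary. A Byzantine adversary makes the corrupted players behave arbitrarily (with randomization); it is rushing, i.e. in each communication round it sees the messages of the honest players before it chooses those of the corrupted ones. The OnlinePSVar mechanism is the mechanism realized by the protocol when all players are honest. **Theorem (OnlinePSVar).** 1. (Stability) For every profile, every assignment $A$ that the OnlinePSVar mechanism returns with positive probability is stable: there is no assignment $A'\ne A$ with $A'_i\succeq_i A_i$ for all players $i$. 2. (Strong equal treatment) For every profile, with induced matrix $P$ of the OnlinePSVar mechanism, all players $i,i'$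 and all $1\le\ell\le n$: if $O_i(k)=O_{i'}(k)$ for all $k\le\ell$, then $P(i,O_i(k))=P(i',O_{i'}(k))$ for all $k\le\ell$. 3. (Uniform dominance) For every declared profile, every set of at most $n-1$ corrupted players, every Byzantine adversary controlling them, and every honest player $i$, the distribution of the item received by $i$ in the OnlinePSVar protocol dominates, with respect to $\succeq_i$, the uniform distribution on the items; that is, for every $1\le\ell\le n$, player $i$ receives one of its top $\ell$ items with probability at least $\ell/n$. -/

import Mathlib

/-! ## Preferences, assignments and mechanisms -/

/-- A preference profile: player `i` has the total order on the items given by its favorite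
function, the bijection `σ i : Fin n ≃ M`.  Ranks are counted from `0`: `σ i k` is the
`(k + 1)`-st favorite item of player `i`. -/
abbrev Profile (n : ℕ) (N M : Type*) := N → (Fin n ≃ M)

/-- A mechanism maps a preference profile to a distribution on assignments.  Assignments are
the bijections from players to items (equivalently, the permutation matrices). -/
abbrev Mechanism (n : ℕ) (N M : Type*) := Profile n N M → PMF (N ≃ M)

/-- Vector dominance `p ⪰ q` with respect to the favorite function `O`: for every rank, the
total weight of the items up to that rank is at least as large under `p` as under `q`. -/
def Dominates {n : ℕ} {M : Type*} (O : Fin n ≃ M) (p q : M → ℝ) : Prop :=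
  ∀ l : Fin n, ∑ k ∈ Finset.Iic l, q (O k) ≤ ∑ k ∈ Finset.Iic l, p (O k)

/-- The `0/1` matrix of an assignment. -/
def assignmentMatrix {N M : Type*} [DecidableEq M] (A : N ≃ M) (i : N) (j : M) : ℝ :=
  if A i = j then 1 else 0

/-- The bistochastic matrix induced by a distribution on assignments; its `(i, j)` entry is the
probability that player `i` receives item `j`. -/
noncomputable def inducedMatrix {N M : Type*} [Fintype N] [Fintype M] [DecidableEq N]
    [DecidableEq M] (ρ : PMF (N ≃ M)) (i : N) (j : M) : ℝ :=
  ∑ A : N ≃ M, (ρ A).toReal * assignmentMatrix A i j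

/-- An assignment is stable if no different assignment dominates it. -/
def StableAssignment {n : ℕ} {N M : Type*} [DecidableEq M] (σ : Profile n N M)
    (A : N ≃ M) : Prop :=
  ¬ ∃ A' : N ≃ M, A' ≠ A ∧
    ∀ i, Dominates (σ i) (assignmentMatrix A' i) (assignmentMatrix A i)

/-- A mechanism is stable if it always produces a stable assignment. -/
def Mechanism.Stable {n : ℕ} {N M : Type*} [DecidableEq M] (μ : Mechanism n N M) : Prop :=
  ∀ σ : Profile n N M, ∀ A ∈ (μ σ).support, StableAssignment σ A

/-- Strong equal treatment: two players with the same preferences on their most favorite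
items, up to some rank, receive each of these items with the same probability. -/
def Mechanism.StrongEqualTreatment {n : ℕ} {N M : Type*} [Fintype N] [Fintype M]
    [DecidableEq N] [DecidableEq M] (μ : Mechanism n N M) : Prop :=
  ∀ (σ : Profile n N M) (i i' : N) (l : Fin n),
    (∀ k ≤ l, σ i k = σ i' k) →
      ∀ k ≤ l, inducedMatrix (μ σ) i (σ i k) = inducedMatrix (μ σ) i' (σ i' k)

/-- Uniform dominance of a protocol against a class `Adv` of adversaries that control up to
`n - 1` players: whatever preference profile has been declared, whichever players `C` are
corrupted and whatever the adversary does, every honest player gets an item distribution that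
dominates the uniform one with respect to its own preferences.  Here `protocol σ C adv` is the
distribution of the final assignment. -/
def UniformDominance {n : ℕ} {N M Adv : Type*} [Fintype N] [Fintype M]
    [DecidableEq N] [DecidableEq M]
    (protocol : Profile n N M → Finset N → Adv → PMF (N ≃ M)) : Prop :=
  ∀ (σ : Profile n N M) (C : Finset N), C.card ≤ n - 1 → ∀ (adv : Adv) (i : N), i ∉ C →
    Dominates (σ i) (inducedMatrix (protocol σ C adv) i) (fun _ => 1 / (n : ℝ))

namespace OnlinePSVar

/-! ## The lottery subroutine: tournament trees of commit-and-open duels -/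

/-- Binary trees with labelled leaves: the shapes of tournament trees. -/
inductive Bracket (α : Type*) where
  | leaf : α → Bracket α
  | duel : Bracket α → Bracket α → Bracket α

/-- The labels of the leaves, from left to right. -/
def Bracket.leaves {α : Type*} : Bracket α → List α
  | .leaf a => [a]
  | .duel l r => l.leaves ++ r.leaves

/-- Relabelling of the leaves. -/
def Bracket.map {α β : Type*} (f : α → β) : Bracket α → Bracket β
  | .leaf a => .leaf (f a)
  | .duel l r => .duel (l.map f) (r.map f)

/-- The messages of one phase, in which a number of duels are run in parallel.  A phase has two
broadcast rounds.  In the first one each player commits to a value (`none`: no commitment is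
sent), in the second one each player opens its commitment or refuses to.  Commitments are ideal:
perfectly hiding until opened, perfectly binding and non-malleable. -/
structure Phase (N : Type*) where
  /-- the committed value of each player -/
  commit : N → Option ℕ
  /-- whether the player opens its commitment -/
  opened : N → Bool

/-- The element of `{0, …, k - 1}` that player `i` reveals; `none` if it aborts or fails to open
its commitment to such an element. -/
def Phase.revealed {N : Type*} (r : Phase N) (k : ℕ) (i : N) : Option ℕ :=
  if r.opened i then (r.commit i).filter (fun v => v < k) else none

/-- A contestant `(i, w)` of a duel is a player `i` together with the total prize fraction `w` of
the subtree that it has won.  The first contestant should win with probability `w₁ / (w₁ + w₂)`. -/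
def duelProb {N : Type*} (a b : N × ℚ) : ℚ := a.2 / (a.2 + b.2)

/-- The modulus `k` of a duel: the winning probability of the first contestant is `k₁ / k`. -/
def duelModulus {N : Type*} (a b : N × ℚ) : ℕ := (duelProb a b).den

/-- The winner of a duel.  If both contestants reveal elements `u`, `v` of `ℤ/k`, the first one
wins if `u + v ∈ {0, …, k₁ - 1}` and the second one otherwise.  If exactly one contestant
fails, the other one wins; if both fail, the first one wins by default. -/
def duelWinner {N : Type*} (r : Phase N) (a b : N × ℚ) : N :=
  match r.revealed (duelModulus a b) a.1, r.revealed (duelModulus a b) b.1 with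
  | some u, some v =>
      if (u + v) % duelModulus a b < (duelProb a b).num.toNat then a.1 else b.1
  | some _, none => a.1
  | none, some _ => b.1
  | none, none => a.1

/-- The contestants of a duel that are identified as corrupted. -/
def duelCaught {N : Type*} [DecidableEq N] (r : Phase N) (a b : N × ℚ) : Finset N :=
  ({a.1, b.1} : Finset N).filter (fun i => r.revealed (duelModulus a b) i = none)

/-- The modulus of the duel that player `i` currently has to play in this tree; it is `1` if
there is no such duel.  The duels that can be played are those between two leaves. -/
def Bracket.modulus {N : Type*} [DecidableEq N] (i : N) : Bracket (N × ℚ) → ℕ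
  | .leaf _ => 1
  | .duel (.leaf a) (.leaf b) => if i = a.1 ∨ i = b.1 then duelModulus a b else 1
  | .duel l r => max (l.modulus i) (r.modulus i)

/-- The tree after one phase: every duel between two leaves is replaced by its winner. -/
def Bracket.advance {N : Type*} (r : Phase N) : Bracket (N × ℚ) → Bracket (N × ℚ)
  | .leaf a => .leaf a
  | .duel (.leaf a) (.leaf b) => .leaf (duelWinner r a b, a.2 + b.2)
  | .duel s t => .duel (s.advance r) (t.advance r)

/-- The players identified as corrupted in the duels of one phase. -/
def Bracket.caught {N : Type*} [DecidableEq N] (r : Phase N) : Bracket (N × ℚ) → Finset N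
  | .leaf _ => ∅
  | .duel (.leaf a) (.leaf b) => duelCaught r a b
  | .duel s t => s.caught r ∪ t.caught r

/-- The winner of a tree all of whose duels have been played. -/
def Bracket.champion {N : Type*} : Bracket (N × ℚ) → Option N
  | .leaf a => some a.1
  | .duel _ _ => none

/-- The tournaments that are run at the same moment, one for each item that has just been
totally consumed (`none` for all other items). -/
abbrev Forest (N M : Type*) := M → Option (Bracket (N × ℚ))

/-- The modulus of the duel that player `i` currently has to play; `1` if there is none. -/
def Forest.modulus {N M : Type*} [DecidableEq N] [Fintype M] (F : Forest N M) (i : N) : ℕ :=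
  max 1 (Finset.univ.sup fun j => (F j).elim 1 (Bracket.modulus i))

/-- All tournaments after one phase. -/
def Forest.advance {N M : Type*} (F : Forest N M) (r : Phase N) : Forest N M :=
  fun j => (F j).map (Bracket.advance r)

/-- All players identified as corrupted in one phase. -/
def Forest.caught {N M : Type*} [DecidableEq N] [Fintype M] (F : Forest N M) (r : Phase N) :
    Finset N :=
  Finset.univ.biUnion fun j => (F j).elim ∅ (Bracket.caught r)

/-- The possible joint values of the players' random elements: player `i` samples from
`{0, …, k - 1}`, where `k` is the modulus of its current duel. -/
def Forest.samples {N M : Type*} [Fintype N] [DecidableEq N] [Fintype M] (F : Forest N M) :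
    Finset (N → ℕ) :=
  Fintype.piFinset fun i => Finset.range (F.modulus i)

theorem Forest.samples_nonempty {N M : Type*} [Fintype N] [DecidableEq N] [Fintype M]
    (F : Forest N M) : F.samples.Nonempty :=
  ⟨fun _ => 0, by simp [Forest.samples, Forest.modulus]⟩

/-- A (randomized, rushing) Byzantine adversary.  In the commit round of a phase it sees the whole
past, including all values that it committed to itself; the commitments that honest players send
in this round tell it nothing.  In the open round it also sees all values opened by the honest
players before it decides which commitments to open.  Its answers for honest players are
ignored. -/
structure Adversary (N : Type*) where
  /-- the commitments of the corrupted players, given the past phases -/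
  commit : List (Phase N) → PMF (N → Option ℕ)
  /-- which commitments of corrupted players are opened, given the past phases and the committed
  values of the current phase -/
  opening : List (Phase N) → (N → Option ℕ) → PMF (N → Bool)

/-- The adversary that never sends anything. -/
noncomputable def Adversary.silent (N : Type*) : Adversary N where
  commit _ := PMF.pure fun _ => none
  opening _ _ := PMF.pure fun _ => false

/-- One phase: every honest player commits to an independent uniformly random element and opens
it; the players in `C` do what the adversary says.  Honest players that have no duel to play
have modulus `1`, hence send the constant `0`. -/
noncomputable def playPhase {N M : Type*} [Fintype N] [DecidableEq N] [Fintype M]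
    (C : Finset N) (adv : Adversary N) (F : Forest N M) (past : List (Phase N)) :
    PMF (Phase N) :=
  (PMF.uniformOfFinset F.samples F.samples_nonempty).bind fun s =>
  (adv.commit past).bind fun a =>
    let c : N → Option ℕ := fun i => if i ∈ C then a i else some (s i)
    (adv.opening past c).bind fun b =>
      PMF.pure ⟨c, fun i => if i ∈ C then b i else true⟩

/-- What the tournaments result in: the final trees, the players identified as corrupted, and the
messages sent so far. -/
structure Outcome (N M : Type*) where
  forest : Forest N M
  caught : Finset N
  past : List (Phase N)

/-- Run the given number of phases of the tournaments. -/
noncomputable def playTournaments {N M : Type*} [Fintype N] [DecidableEq N] [Fintype M]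
    (C : Finset N) (adv : Adversary N) : ℕ → Outcome N M → PMF (Outcome N M)
  | 0, o => PMF.pure o
  | f + 1, o => (playPhase C adv o.forest o.past).bind fun r =>
      playTournaments C adv f
        ⟨o.forest.advance r, o.caught ∪ o.forest.caught r, o.past ++ [r]⟩

/-! ## The consumption process -/

/-- The choices that the protocol leaves open: a tournament tree for each set of candidates, and
the rule by which items that remain at the end are assigned to players without an item. -/
structure Rules (N M : Type*) [DecidableEq N] where
  /-- the tournament tree for a set of candidates -/
  bracket : (S : Finset N) → S.Nonempty → Bracket N
  /-- each candidate occurs exactly once in the tree, and nobody else does -/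
  nodup_leaves : ∀ S hS, (bracket S hS).leaves.Nodup
  mem_leaves : ∀ S hS i, i ∈ (bracket S hS).leaves ↔ i ∈ S
  /-- the completion of a partial assignment (item `j` is given to the player `h j`, if any) -/
  complete : (M → Option N) → (N ≃ M)
  /-- items that have been assigned already, to different players, stay assigned -/
  complete_eq : ∀ h : M → Option N, (∀ j j' i, h j = some i → h j' = some i → j = j') →
    ∀ j i, h j = some i → complete h i = j

/-- The state of the consumption process. -/
structure State (N M : Type*) where
  /-- the current time -/
  time : ℚ
  /-- the consumption rate of each player -/
  rate : N → ℚ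
  /-- `share i j` is the fraction of item `j` consumed by player `i` so far -/
  share : N → M → ℚ
  /-- the items that are not totally consumed -/
  remaining : Finset M
  /-- the player to which an item has been assigned, if any -/
  holder : M → Option N

/-- Initially all rates are `1`, and nothing is consumed or assigned. -/
def State.init (N M : Type*) [Fintype M] : State N M where
  time := 0
  rate _ := 1
  share _ _ := 0
  remaining := Finset.univ
  holder _ := none

section Consumption

variable {n : ℕ} {N M : Type*} [Fintype N] [DecidableEq N] [Fintype M] [DecidableEq M]

/-- Player `i` is currently consuming item `j`: it has positive rate, and `j` is its favorite item
among those not totally consumed. -/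
def State.Consumes (st : State N M) (σ : Profile n N M) (i : N) (j : M) : Prop :=
  0 < st.rate i ∧ j ∈ st.remaining ∧ ∀ j' ∈ st.remaining, (σ i).symm j ≤ (σ i).symm j'

instance (st : State N M) (σ : Profile n N M) (i : N) (j : M) :
    Decidable (st.Consumes σ i j) := by
  unfold State.Consumes; infer_instance

/-- The total rate at which item `j` is being consumed. -/
def State.demand (st : State N M) (σ : Profile n N M) (j : M) : ℚ :=
  ∑ i with st.Consumes σ i j, st.rate i

/-- The time until the next item is totally consumed (`0` if nothing is being consumed). -/
def State.delay (st : State N M) (σ : Profile n N M) : ℚ :=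
  if h : (Finset.univ.filter fun j => 0 < st.demand σ j).Nonempty then
    (Finset.univ.filter fun j => 0 < st.demand σ j).inf' h
      fun j => (1 - ∑ i, st.share i j) / st.demand σ j
  else 0

/-- Let the players consume until the next item is totally consumed. -/
def State.consume (st : State N M) (σ : Profile n N M) : State N M :=
  { st with
    time := st.time + st.delay σ
    share := fun i j => st.share i j + if st.Consumes σ i j then st.rate i * st.delay σ else 0 }

/-- The items that have just been totally consumed. -/
def State.finished (st : State N M) : Finset M :=
  st.remaining.filter fun j => ∑ i, st.share i j = 1

/-- The players that have consumed a positive fraction of item `j`. -/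
def State.candidates (st : State N M) (j : M) : Finset N :=
  Finset.univ.filter fun i => 0 < st.share i j

/-- The tournaments for the items that have just been totally consumed: the candidates for item
`j` play with winning probabilities equal to their fractions of `j`. -/
def State.forest (st : State N M) (R : Rules N M) : Forest N M := fun j =>
  if h : j ∈ st.finished ∧ (st.candidates j).Nonempty then
    some ((R.bracket (st.candidates j) h.2).map fun i => (i, st.share i j))
  else none

/-- The part of the winner's rate that is passed on to the survivor `i` of the tournament for item
`j` with the given winner. -/
def State.bonus (st : State N M) (j : M) (winner : Option N) (i : N) : ℚ :=
  match winner with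
  | some w => st.rate w * (st.share i j / ∑ k ∈ (st.candidates j).erase w, st.share k j)
  | none => 0

/-- Update the state after the tournaments: the items are assigned to the winners, each survivor
(a candidate that neither wins nor is identified as corrupted) gets its part of the
winner's rate, and the rates of all other candidates are set to `0`. -/
def State.update (st : State N M) (o : Outcome N M) : State N M :=
  let winner : M → Option N := fun j => (o.forest j).bind Bracket.champion
  { time := st.time
    share := st.share
    remaining := st.remaining \ st.finished
    holder := fun j => if j ∈ st.finished then winner j else st.holder j
    rate := fun i =>
      if ∃ j ∈ st.finished, i ∈ st.candidates j ∧ (winner j = some i ∨ i ∈ o.caught) then 0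
      else st.rate i +
        ∑ j ∈ st.finished with i ∈ st.candidates j, st.bonus j (winner j) i }

/-- The main loop: as long as some player has positive rate, consume until the next item is
totally consumed, run the tournaments and update the state.  The first argument bounds the
number of iterations.  A tree with `m` distinct leaves is decided after at most `m - 1`
phases, so that `Fintype.card N` phases suffice for the tournaments. -/
noncomputable def run (R : Rules N M) (σ : Profile n N M) (C : Finset N) (adv : Adversary N) :
    ℕ → State N M → List (Phase N) → PMF (State N M)
  | 0, st, _ => PMF.pure st
  | f + 1, st, past =>
      if ∃ i, 0 < st.rate i then
        (playTournaments C adv (Fintype.card N)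
          ⟨(st.consume σ).forest R, ∅, past⟩).bind fun o =>
            run R σ C adv f ((st.consume σ).update o) o.past
      else PMF.pure st

/-- The OnlinePSVar protocol: the distribution of the final assignment when the players in `C` are
controlled by the adversary `adv`.  Each iteration of the main loop consumes at least one
item, so that `Fintype.card M` iterations suffice. -/
noncomputable def protocol (R : Rules N M) (σ : Profile n N M) (C : Finset N)
    (adv : Adversary N) : PMF (N ≃ M) :=
  (run R σ C adv (Fintype.card M) (State.init N M) []).map fun st => R.complete st.holder

/-- The OnlinePSVar mechanism: the protocol when all players are honest. -/
noncomputable def mechanism (R : Rules N M) : Mechanism n N M := fun σ =>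
  protocol R σ ∅ (Adversary.silent N)

end Consumption

end OnlinePSVar

/-! Lottery. The weight of a player in a tournament tree is the prize fraction at the leaf it
currently holds. A duel replaces the weights `w₁`, `w₂` by `w₁ + w₂` for the winner and `0` for the
loser. If one element is uniform and the other was committed independently of it, their sum is
uniform in `ℤ/k`, so the duel is a fair game; refusing to open can only help an honest opponent.
Hence the weight of an honest player is a submartingale against any adversary
(`treeWeight_le_expect`). If all are honest, products of weights over different trees, which have
disjoint players, are martingales. So the winners are independent, with probabilities equal to the
consumed fractions (`expect_winner`).

Consumption. A player with positive rate `s` at time `t` that has consumed the fraction `p` of its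
current item satisfies `s (1 - t) + p = 1` (`balance`). The bonus rule preserves this: a survivor of
a tournament restarts with rate `1 / (1 - t)` (`Invariant.rate_update_mul`). Summing over the
players bounds the total rate, so at most `n t` items are consumed by time `t` (`consumed_le`).

Uniform dominance. While one of the top `L` items of an honest player with rate `s` remains, the
player ends up with none of them with probability at most `s (1 - L / n)` (`expect_fail_le`).
Indeed, it loses its current item with probability at most `1 - p = s (1 - t)` and then has rate `1
/ (1 - t)`. If its top `L` items are gone by then, `L ≤ n t`, and `(1 - L / n) / (1 - t) ≥ 1` is a
trivial bound. At the start `s = 1`.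

Stability. As in a serial dictatorship, every winner gets its favorite among the items that
remained, so a dominating assignment must agree with the outcome on one batch of finished items
after the other.

Strong equal treatment. The honest process is a Markov chain whose transitions depend on the
fractions only, not on the trees. As long as the item of rank `k` remains, two players that agree up
to rank `k` have the same favorite, so exchanging them commutes with the process
(`expect_run_relabel`); once the item is consumed, its holder is final. -/

open scoped ENNReal

set_option linter.unusedSectionVars false

/-! ## Expectations with respect to a `PMF` -/

/-- The expectation of a nonnegative function. -/
noncomputable def PMF.expect {α : Type*} (p : PMF α) (f : α → ℝ≥0∞) : ℝ≥0∞ := ∑' a, p a * f a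

namespace PMF

variable {α β : Type*}

theorem expect_pure (a : α) (f : α → ℝ≥0∞) : (PMF.pure a).expect f = f a := by
  classical
  rw [expect, tsum_eq_single a]
  · simp
  · intro b hb; simp [PMF.pure_apply, hb]

theorem expect_bind (p : PMF α) (q : α → PMF β) (f : β → ℝ≥0∞) :
    (p.bind q).expect f = p.expect fun a => (q a).expect f := by
  simp only [expect, PMF.bind_apply, ← ENNReal.tsum_mul_right, ← ENNReal.tsum_mul_left]
  rw [ENNReal.tsum_comm]
  simp only [mul_assoc]

theorem expect_map (p : PMF α) (g : α → β) (f : β → ℝ≥0∞) :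
    (p.map g).expect f = p.expect fun a => f (g a) := by
  rw [← PMF.bind_pure_comp, expect_bind]
  simp [expect_pure]

theorem expect_mono {p : PMF α} {f g : α → ℝ≥0∞} (h : ∀ a ∈ p.support, f a ≤ g a) :
    p.expect f ≤ p.expect g := by
  refine ENNReal.tsum_le_tsum fun a => ?_
  by_cases ha : p a = 0
  · simp [ha]
  · gcongr
    exact h a ((PMF.mem_support_iff _ _).2 ha)

theorem expect_congr {p : PMF α} {f g : α → ℝ≥0∞} (h : ∀ a ∈ p.support, f a = g a) :
    p.expect f = p.expect g :=
  le_antisymm (expect_mono fun a ha => (h a ha).le) (expect_mono fun a ha => (h a ha).ge)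

theorem expect_const (p : PMF α) (c : ℝ≥0∞) : (p.expect fun _ => c) = c := by
  rw [expect, ENNReal.tsum_mul_right, p.tsum_coe, one_mul]

theorem expect_add (p : PMF α) (f g : α → ℝ≥0∞) :
    (p.expect fun a => f a + g a) = p.expect f + p.expect g := by
  simp only [expect, mul_add, ENNReal.tsum_add]

theorem expect_const_mul (p : PMF α) (c : ℝ≥0∞) (f : α → ℝ≥0∞) :
    (p.expect fun a => c * f a) = c * p.expect f := by
  simp only [expect, ← ENNReal.tsum_mul_left]
  exact tsum_congr fun a => by ring

theorem expect_finsetSum {ι : Type*} (p : PMF α) (s : Finset ι) (f : ι → α → ℝ≥0∞) :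
    (p.expect fun a => ∑ x ∈ s, f x a) = ∑ x ∈ s, p.expect (f x) := by
  classical
  induction s using Finset.induction_on with
  | empty => simp [expect]
  | insert x s hx ih => simp only [Finset.sum_insert hx, expect_add, ih]

theorem expect_fintype [Fintype α] (p : PMF α) (f : α → ℝ≥0∞) :
    p.expect f = ∑ a, p a * f a := tsum_fintype _

theorem expect_uniformOfFinset (s : Finset α) (hs : s.Nonempty) (f : α → ℝ≥0∞) :
    (PMF.uniformOfFinset s hs).expect f = (s.card : ℝ≥0∞)⁻¹ * ∑ a ∈ s, f a := by
  classical
  rw [expect, tsum_eq_sum (s := s), Finset.mul_sum]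
  · exact Finset.sum_congr rfl fun a ha => by rw [PMF.uniformOfFinset_apply_of_mem hs ha]
  · intro a ha
    simp [PMF.uniformOfFinset_apply_of_notMem hs ha]

end PMF

/-! ## Averaging over one coordinate of a product, and counting residues -/

section Averaging

variable {ι : Type*} [Fintype ι] [DecidableEq ι]

/-- Exchanging `v` with the coordinate `s x` is an involution on the pairs `(s, v)`. -/
theorem sum_piFinset_sum_update (S : ι → Finset ℕ) (x : ι) (f : (ι → ℕ) → ℝ≥0∞) :
    ∑ s ∈ Fintype.piFinset S, ∑ v ∈ S x, f (Function.update s x v) =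
      (S x).card * ∑ s ∈ Fintype.piFinset S, f s := by
  have : ((S x).card : ℝ≥0∞) * ∑ s ∈ Fintype.piFinset S, f s =
      ∑ s ∈ Fintype.piFinset S, ∑ _v ∈ S x, f s := by
    simp [Finset.mul_sum]
  rw [this, ← Finset.sum_product', ← Finset.sum_product']
  refine Finset.sum_nbij' (fun q => (Function.update q.1 x q.2, q.1 x))
    (fun q => (Function.update q.1 x q.2, q.1 x)) ?_ ?_ ?_ ?_ ?_
  · rintro ⟨s, v⟩ h
    simp only [Finset.mem_product, Fintype.mem_piFinset] at h ⊢
    refine ⟨fun a => ?_, h.1 x⟩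
    by_cases ha : a = x
    · subst ha; simpa using h.2
    · simpa [ha] using h.1 a
  · rintro ⟨s, v⟩ h
    simp only [Finset.mem_product, Fintype.mem_piFinset] at h ⊢
    refine ⟨fun a => ?_, h.1 x⟩
    by_cases ha : a = x
    · subst ha; simpa using h.2
    · simpa [ha] using h.1 a
  · rintro ⟨s, v⟩ _; simp
  · rintro ⟨s, v⟩ _; simp
  · rintro ⟨s, v⟩ _; simp

/-- This is conditioning on all coordinates but `x`. It is applied with `x` an honest player, so
that only its own random element is averaged. -/
theorem sum_piFinset_le_of_coordinate (S : ι → Finset ℕ) (x : ι) (f g : (ι → ℕ) → ℝ≥0∞)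
    (h : ∀ s ∈ Fintype.piFinset S,
      ∑ v ∈ S x, f (Function.update s x v) ≤ ∑ v ∈ S x, g (Function.update s x v)) :
    ∑ s ∈ Fintype.piFinset S, f s ≤ ∑ s ∈ Fintype.piFinset S, g s := by
  rcases (S x).eq_empty_or_nonempty with he | hne
  · have : Fintype.piFinset S = ∅ := Finset.eq_empty_of_forall_notMem fun s hs => by
      simpa [he] using Fintype.mem_piFinset.1 hs x
    simp [this]
  · have key := Finset.sum_le_sum h
    rw [sum_piFinset_sum_update, sum_piFinset_sum_update] at key
    have h0 : ((S x).card : ℝ≥0∞) ≠ 0 := by simpa using hne.ne_empty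
    exact (ENNReal.mul_le_mul_iff_right h0 (ENNReal.natCast_ne_top _)).1 key

theorem sum_piFinset_eq_of_coordinate (S : ι → Finset ℕ) (x : ι) (f g : (ι → ℕ) → ℝ≥0∞)
    (h : ∀ s ∈ Fintype.piFinset S,
      ∑ v ∈ S x, f (Function.update s x v) = ∑ v ∈ S x, g (Function.update s x v)) :
    ∑ s ∈ Fintype.piFinset S, f s = ∑ s ∈ Fintype.piFinset S, g s :=
  le_antisymm (sum_piFinset_le_of_coordinate S x f g fun s hs => (h s hs).le)
    (sum_piFinset_le_of_coordinate S x g f fun s hs => (h s hs).ge)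

end Averaging

/-- The numbers `u, …, u + k - 1` represent each residue once. As `u` is arbitrary, one uniform
summand suffices for a uniform sum. -/
theorem card_filter_add_mod_lt {k m : ℕ} (hm : m ≤ k) (u : ℕ) :
    ((Finset.range k).filter fun v => (u + v) % k < m).card = m := by
  have hp : Function.Periodic (fun v => v % k < m) k := fun v => by simp
  have h1 := Nat.filter_Ico_card_eq_of_periodic u k (fun v => v % k < m) hp
  have h2 : k.count (fun v => v % k < m) = m := by
    rw [Nat.count_eq_card_filter_range]
    have : (Finset.range k).filter (fun v => v % k < m) = Finset.range m := by
      ext v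
      simp only [Finset.mem_filter, Finset.mem_range]
      constructor
      · rintro ⟨hv, h⟩; rwa [Nat.mod_eq_of_lt hv] at h
      · intro h; have hv := h.trans_le hm; exact ⟨hv, by rwa [Nat.mod_eq_of_lt hv]⟩
    rw [this, Finset.card_range]
  rw [h2] at h1
  conv_rhs => rw [← h1]
  refine Finset.card_nbij' (fun v => u + v) (fun v => v - u) ?_ ?_ ?_ ?_
  · intro v; simp
  · intro v
    simp only [Finset.coe_filter, Finset.mem_Ico, Finset.mem_range, Set.mem_ofPred_eq]
    rintro ⟨⟨h1, h2⟩, h3⟩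
    exact ⟨by omega, by rwa [Nat.add_sub_cancel' h1]⟩
  · intro v; simp
  · intro v
    simp only [Finset.coe_filter, Finset.mem_Ico, Set.mem_ofPred_eq]
    rintro ⟨⟨h1, h2⟩, h3⟩
    omega

namespace OnlinePSVar

/-! ## Tournament trees -/

namespace Bracket

variable {N : Type*}

/-- The players at the leaves of a weighted tree. -/
def players (B : Bracket (N × ℚ)) : List N := B.leaves.map Prod.fst

/-- The total weight of the leaves. -/
def total (B : Bracket (N × ℚ)) : ℚ := (B.leaves.map Prod.snd).sum

/-- The weight of the leaves of player `i`. -/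
def weight [DecidableEq N] (i : N) (B : Bracket (N × ℚ)) : ℚ :=
  (B.leaves.map fun a => if a.1 = i then a.2 else 0).sum

/-- The depth of a tree. -/
def depth {α : Type*} : Bracket α → ℕ
  | .leaf _ => 0
  | .duel l r => max l.depth r.depth + 1

@[simp] theorem players_leaf (a : N × ℚ) : players (.leaf a) = [a.1] := rfl
@[simp] theorem players_duel (s t : Bracket (N × ℚ)) :
    players (.duel s t) = s.players ++ t.players := by simp [players, leaves]
@[simp] theorem total_leaf (a : N × ℚ) : total (.leaf a) = a.2 := by simp [total, leaves]
@[simp] theorem total_duel (s t : Bracket (N × ℚ)) :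
    total (.duel s t) = s.total + t.total := by simp [total, leaves]
@[simp] theorem weight_leaf [DecidableEq N] (i : N) (a : N × ℚ) :
    weight i (.leaf a) = if a.1 = i then a.2 else 0 := by simp [weight, leaves]
@[simp] theorem weight_duel [DecidableEq N] (i : N) (s t : Bracket (N × ℚ)) :
    weight i (.duel s t) = s.weight i + t.weight i := by simp [weight, leaves]
@[simp] theorem leaves_leaf {α : Type*} (a : α) : leaves (.leaf a) = [a] := rfl
@[simp] theorem leaves_duel {α : Type*} (s t : Bracket α) :
    leaves (.duel s t) = s.leaves ++ t.leaves := rfl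

theorem leaves_map {α β : Type*} (f : α → β) (B : Bracket α) :
    (B.map f).leaves = B.leaves.map f := by
  induction B with
  | leaf a => rfl
  | duel s t hs ht => simp [map, hs, ht]

theorem depth_lt_length {α : Type*} (B : Bracket α) : B.depth < B.leaves.length := by
  induction B with
  | leaf a => simp [depth]
  | duel s t hs ht => simp only [depth, leaves_duel, List.length_append]; omega

/-- A tree is played by treating duels between two leaves separately. -/
theorem playInduction {α : Type*} {motive : Bracket α → Prop} (leaf : ∀ a, motive (.leaf a))
    (pair : ∀ a b, motive (.duel (.leaf a) (.leaf b)))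
    (node : ∀ s t, 0 < max s.depth t.depth → motive s → motive t → motive (.duel s t)) :
    ∀ B, motive B := by
  intro B
  induction B with
  | leaf a => exact leaf a
  | duel s t hs ht =>
    cases s with
    | leaf a =>
      cases t with
      | leaf b => exact pair a b
      | duel _ _ => exact node _ _ (by simp [depth]) hs ht
    | duel _ _ => exact node _ _ (by simp [depth]) hs ht

theorem advance_duel (r : Phase N) {s t : Bracket (N × ℚ)} (h : 0 < max s.depth t.depth) :
    advance r (.duel s t) = .duel (s.advance r) (t.advance r) := by
  cases s <;> cases t <;> first | rfl | simp [depth] at h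

theorem modulus_duel [DecidableEq N] (i : N) {s t : Bracket (N × ℚ)}
    (h : 0 < max s.depth t.depth) : modulus i (.duel s t) = max (s.modulus i) (t.modulus i) := by
  cases s <;> cases t <;> first | rfl | simp [depth] at h

theorem caught_duel [DecidableEq N] (r : Phase N) {s t : Bracket (N × ℚ)}
    (h : 0 < max s.depth t.depth) : caught r (.duel s t) = s.caught r ∪ t.caught r := by
  cases s <;> cases t <;> first | rfl | simp [depth] at h

theorem _root_.OnlinePSVar.duelWinner_eq_or (r : Phase N) (a b : N × ℚ) :
    duelWinner r a b = a.1 ∨ duelWinner r a b = b.1 := by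
  unfold duelWinner
  split <;> first | exact ite_eq_or_eq _ _ _ | simp

theorem players_advance_sublist (r : Phase N) (B : Bracket (N × ℚ)) :
    (B.advance r).players.Sublist B.players := by
  induction B using playInduction with
  | leaf a => simp [advance]
  | pair a b =>
    rcases duelWinner_eq_or r a b with h | h <;> simp [advance, h]
  | node s t h hs ht => rw [advance_duel r h]; simpa using hs.append ht

theorem total_advance (r : Phase N) (B : Bracket (N × ℚ)) : (B.advance r).total = B.total := by
  induction B using playInduction with
  | leaf a => rfl
  | pair a b => simp [advance]
  | node s t h hs ht => rw [advance_duel r h]; simp [hs, ht]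

theorem depth_advance_le (r : Phase N) (B : Bracket (N × ℚ)) :
    (B.advance r).depth ≤ B.depth - 1 := by
  induction B using playInduction with
  | leaf a => simp [advance, depth]
  | pair a b => simp [advance, depth]
  | node s t h hs ht => rw [advance_duel r h]; simp only [depth]; omega

theorem pos_advance (r : Phase N) {B : Bracket (N × ℚ)} (hB : ∀ a ∈ B.leaves, 0 < a.2) :
    ∀ a ∈ (B.advance r).leaves, 0 < a.2 := by
  induction B using playInduction with
  | leaf a => exact hB
  | pair a b =>
    simp only [leaves_duel, leaves_leaf, List.mem_append, List.mem_singleton] at hB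
    have ha := hB a (.inl rfl)
    have hb := hB b (.inr rfl)
    simp only [advance, leaves_leaf, List.mem_singleton]
    rintro _ rfl
    exact add_pos ha hb
  | node s t h hs ht =>
    rw [advance_duel r h]
    simp only [leaves_duel, List.mem_append] at hB ⊢
    rintro a (ha | ha)
    · exact hs (fun a ha => hB a (.inl ha)) a ha
    · exact ht (fun a ha => hB a (.inr ha)) a ha

/-- A tree only sees the messages of its own players, which makes parallel tournaments independent.
-/
theorem advance_congr {r r' : Phase N} {B : Bracket (N × ℚ)}
    (h : ∀ x ∈ B.players, r.commit x = r'.commit x ∧ r.opened x = r'.opened x) :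
    B.advance r = B.advance r' := by
  induction B using playInduction with
  | leaf a => rfl
  | pair a b =>
    have ha := h a.1 (by simp)
    have hb := h b.1 (by simp)
    simp [advance, duelWinner, Phase.revealed, ha, hb]
  | node s t hd hs ht =>
    rw [advance_duel r hd, advance_duel r' hd, hs fun x hx => h x (by simp [hx]),
      ht fun x hx => h x (by simp [hx])]

variable [DecidableEq N]

theorem weight_eq_zero {i : N} {B : Bracket (N × ℚ)} (h : i ∉ B.players) : B.weight i = 0 := by
  induction B with
  | leaf a => simp only [players_leaf, List.mem_singleton] at h; simp [Ne.symm h]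
  | duel s t hs ht =>
    simp only [players_duel, List.mem_append, not_or] at h
    simp [hs h.1, ht h.2]

theorem weight_nonneg {B : Bracket (N × ℚ)} (hB : ∀ a ∈ B.leaves, 0 < a.2) (i : N) :
    0 ≤ B.weight i := by
  refine List.sum_nonneg ?_
  simp only [List.mem_map]
  rintro _ ⟨a, ha, rfl⟩
  split_ifs
  · exact (hB a ha).le
  · exact le_rfl

theorem one_le_modulus (i : N) (B : Bracket (N × ℚ)) : 1 ≤ B.modulus i := by
  induction B using playInduction with
  | leaf a => exact le_rfl
  | pair a b =>
    simp only [modulus]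
    split_ifs
    · exact (duelProb a b).pos
    · exact le_rfl
  | node s t h hs ht => rw [modulus_duel i h]; omega

theorem modulus_eq_one {i : N} {B : Bracket (N × ℚ)} (h : i ∉ B.players) : B.modulus i = 1 := by
  induction B using playInduction with
  | leaf a => rfl
  | pair a b => simp at h; simp [modulus, h]
  | node s t hd hs ht =>
    simp only [players_duel, List.mem_append, not_or] at h
    rw [modulus_duel i hd, hs h.1, ht h.2, max_self]

theorem mem_players_of_mem_caught {i : N} {r : Phase N} {B : Bracket (N × ℚ)}
    (h : i ∈ B.caught r) : i ∈ B.players := by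
  induction B using playInduction with
  | leaf a => simp [caught] at h
  | pair a b => simp [caught, duelCaught] at h; simpa using h.1
  | node s t hd hs ht =>
    rw [caught_duel r hd, Finset.mem_union] at h
    simpa using h.imp hs ht

/-- In one phase, player `i` either rests or plays a single duel. -/
theorem rests_or_duels {B : Bracket (N × ℚ)} (hn : B.players.Nodup) {i : N}
    (hi : i ∈ B.players) :
    (∀ r, (B.advance r).weight i = B.weight i ∧ i ∉ B.caught r) ∨
    ∃ a b, a ∈ B.leaves ∧ b ∈ B.leaves ∧ a.1 ≠ b.1 ∧
      (i = a.1 ∧ B.weight i = a.2 ∨ i = b.1 ∧ B.weight i = b.2) ∧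
      B.modulus a.1 = duelModulus a b ∧ B.modulus b.1 = duelModulus a b ∧
      ∀ r, ((B.advance r).weight i = if duelWinner r a b = i then a.2 + b.2 else 0) ∧
        (i ∈ B.caught r → r.revealed (duelModulus a b) i = none) := by
  induction B using playInduction with
  | leaf a => left; intro r; simp [advance, caught]
  | pair a b =>
    right
    simp only [players_duel, players_leaf, List.cons_append, List.nil_append, List.nodup_cons,
      List.mem_singleton, List.not_mem_nil, not_false_eq_true, List.nodup_nil, and_true] at hn
    refine ⟨a, b, by simp, by simp, hn, ?_, by simp [modulus], by simp [modulus], fun r => ?_⟩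
    · simp only [players_duel, players_leaf, List.cons_append, List.nil_append, List.mem_cons,
        List.not_mem_nil, or_false] at hi
      rcases hi with rfl | rfl
      · simp [Ne.symm hn]
      · simp [hn]
    · simp [advance, caught, duelCaught]
  | node s t hd hs ht =>
    rw [players_duel, List.nodup_append'] at hn
    obtain ⟨hns, hnt, hdis⟩ := hn
    -- The two subtrees have disjoint players, so the weight, the modulus and the detection of `i`
    -- in the whole tree are those in its own subtree.
    have key : ∀ x, x ∈ s.players → x ∉ t.players := fun x h h' => hdis h h'
    rw [players_duel, List.mem_append] at hi
    have hsub := fun r => (players_advance_sublist r t).subset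
    have hsub' := fun r => (players_advance_sublist r s).subset
    rcases hi with hi | hi
    · have hi' := key i hi
      have e1 : ∀ r, (advance r (.duel s t)).weight i = (s.advance r).weight i := fun r => by
        rw [advance_duel r hd, weight_duel, weight_eq_zero fun h => hi' (hsub r h), add_zero]
      have e2 : weight i (.duel s t) = s.weight i := by rw [weight_duel, weight_eq_zero hi', add_zero]
      have e3 : ∀ r, i ∈ caught r (.duel s t) ↔ i ∈ s.caught r := fun r => by
        rw [caught_duel r hd, Finset.mem_union]
        exact or_iff_left fun h => hi' (mem_players_of_mem_caught h)
      have e4 : ∀ x ∈ s.players, modulus x (.duel s t) = s.modulus x := fun x hx => by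
        rw [modulus_duel x hd, modulus_eq_one (key x hx), max_eq_left (one_le_modulus _ _)]
      rcases hs hns hi with h | ⟨a, b, ha, hb, hab, hw, ma, mb, h⟩
      · left; intro r; rw [e1, e2, e3]; exact h r
      · right
        refine ⟨a, b, by simp [ha], by simp [hb], hab, by rwa [e2], ?_, ?_, fun r => ?_⟩
        · rw [e4 _ (List.mem_map_of_mem ha), ma]
        · rw [e4 _ (List.mem_map_of_mem hb), mb]
        · rw [e1, e3]; exact h r
    · have hi' : i ∉ s.players := fun h => key i h hi
      have e1 : ∀ r, (advance r (.duel s t)).weight i = (t.advance r).weight i := fun r => by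
        rw [advance_duel r hd, weight_duel, weight_eq_zero fun h => hi' (hsub' r h), zero_add]
      have e2 : weight i (.duel s t) = t.weight i := by rw [weight_duel, weight_eq_zero hi', zero_add]
      have e3 : ∀ r, i ∈ caught r (.duel s t) ↔ i ∈ t.caught r := fun r => by
        rw [caught_duel r hd, Finset.mem_union]
        exact or_iff_right fun h => hi' (mem_players_of_mem_caught h)
      have e4 : ∀ x ∈ t.players, modulus x (.duel s t) = t.modulus x := fun x hx => by
        rw [modulus_duel x hd, modulus_eq_one fun h => key x h hx,
          max_eq_right (one_le_modulus _ _)]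
      rcases ht hnt hi with h | ⟨a, b, ha, hb, hab, hw, ma, mb, h⟩
      · left; intro r; rw [e1, e2, e3]; exact h r
      · right
        refine ⟨a, b, by simp [ha], by simp [hb], hab, by rwa [e2], ?_, ?_, fun r => ?_⟩
        · rw [e4 _ (List.mem_map_of_mem ha), ma]
        · rw [e4 _ (List.mem_map_of_mem hb), mb]
        · rw [e1, e3]; exact h r

end Bracket

/-! ### A single duel as a fair game. -/

section Duel

variable {N : Type*}

theorem revealed_eq_some {r : Phase N} {k v : ℕ} {i : N} (ho : r.opened i = true)
    (hc : r.commit i = some v) (hv : v < k) : r.revealed k i = some v := by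
  simp [Phase.revealed, ho, hc, Option.filter, hv]

theorem revealed_eq_none_or {r : Phase N} {i : N} (k : ℕ) :
    r.revealed k i = none ∨ ∃ u, r.commit i = some u ∧ r.revealed k i = some u := by
  unfold Phase.revealed
  split_ifs
  · cases h : r.commit i with
    | none => simp
    | some u =>
      by_cases hu : u < k <;> simp [Option.filter, hu]
  · simp

/-- The alternative `none` covers an opponent that does not open after seeing an unfavorable sum: it
loses anyway. -/
theorem duelWinner_of_mod_lt {r : Phase N} {a b : N × ℚ} {u v : ℕ}
    (ha : r.revealed (duelModulus a b) a.1 = some u)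
    (hb : r.revealed (duelModulus a b) b.1 = none ∨ r.revealed (duelModulus a b) b.1 = some v)
    (h : (u + v) % duelModulus a b < (duelProb a b).num.toNat) : duelWinner r a b = a.1 := by
  rcases hb with hb | hb <;> simp [duelWinner, ha, hb, h]

theorem duelWinner_of_le_mod {r : Phase N} {a b : N × ℚ} {u v : ℕ}
    (hb : r.revealed (duelModulus a b) b.1 = some v)
    (ha : r.revealed (duelModulus a b) a.1 = none ∨ r.revealed (duelModulus a b) a.1 = some u)
    (h : ¬ (u + v) % duelModulus a b < (duelProb a b).num.toNat) : duelWinner r a b = b.1 := by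
  rcases ha with ha | ha <;> simp only [duelWinner, ha, hb]
  rw [if_neg h]

variable {a b : N × ℚ}

theorem duelProb_num_le (ha : 0 < a.2) (hb : 0 < b.2) :
    (duelProb a b).num.toNat ≤ duelModulus a b := by
  have h1 : duelProb a b ≤ 1 := by
    unfold duelProb
    rw [div_le_one (by positivity)]
    linarith
  have := Rat.num_le_denom_iff.2 h1
  simp only [duelModulus]
  omega

theorem duelProb_num_mul (ha : 0 < a.2) (hb : 0 < b.2) :
    ((duelProb a b).num.toNat : ℚ) * (a.2 + b.2) = duelModulus a b * a.2 := by
  have h0 : 0 ≤ duelProb a b := by unfold duelProb; positivity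
  have hn : (((duelProb a b).num.toNat : ℤ) : ℚ) = (duelProb a b).num := by
    rw [Int.toNat_of_nonneg (Rat.num_nonneg.2 h0)]
  have h1 : ((duelProb a b).num : ℚ) = duelModulus a b * duelProb a b :=
    (Rat.den_mul_eq_num _).symm
  rw [Int.cast_natCast] at hn
  rw [hn, h1, duelProb]
  have : a.2 + b.2 ≠ 0 := by positivity
  field_simp

/-- Exactly `k₁` of the `k` elements win, and `k₁ (w₁ + w₂) = k w₁`: the expected weight after the
duel is the weight before it, for every fixed `u`. -/
theorem sum_range_ite_mod_lt (ha : 0 < a.2) (hb : 0 < b.2) (u : ℕ) :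
    ∑ v ∈ Finset.range (duelModulus a b),
      (if (u + v) % duelModulus a b < (duelProb a b).num.toNat then a.2 + b.2 else 0) =
      duelModulus a b * a.2 := by
  rw [← Finset.sum_filter, Finset.sum_const, card_filter_add_mod_lt (duelProb_num_le ha hb),
    nsmul_eq_mul, duelProb_num_mul ha hb]

theorem sum_range_ite_le_mod (ha : 0 < a.2) (hb : 0 < b.2) (u : ℕ) :
    ∑ v ∈ Finset.range (duelModulus a b),
      (if (u + v) % duelModulus a b < (duelProb a b).num.toNat then 0 else a.2 + b.2) =
      duelModulus a b * b.2 := by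
  have h := sum_range_ite_mod_lt ha hb u
  have : ∑ v ∈ Finset.range (duelModulus a b),
      ((if (u + v) % duelModulus a b < (duelProb a b).num.toNat then a.2 + b.2 else 0) +
      (if (u + v) % duelModulus a b < (duelProb a b).num.toNat then 0 else a.2 + b.2)) =
      duelModulus a b * (a.2 + b.2) := by
    rw [Finset.sum_congr rfl fun v _ => show _ = a.2 + b.2 by split_ifs <;> simp]
    simp [mul_add]
  rw [Finset.sum_add_distrib, h] at this
  linarith

end Duel

/-! ### The expected weight of a player after one phase. -/

namespace Bracket

variable {N : Type*} [DecidableEq N]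

/-- On average over its own random element, the weight of a player that follows the protocol
does not decrease in one phase, whatever the others commit to and open. -/
theorem le_sum_weight_advance {B : Bracket (N × ℚ)} (hn : B.players.Nodup)
    (hp : ∀ a ∈ B.leaves, 0 < a.2) {i : N} (hi : i ∈ B.players) {r : ℕ → Phase N}
    (hc : ∀ v, (r v).commit i = some v) (ho : ∀ v, (r v).opened i = true)
    (hx : ∀ x ≠ i, ∃ c, ∀ v, (r v).commit x = c) :
    (B.modulus i : ℚ) * B.weight i ≤
      ∑ v ∈ Finset.range (B.modulus i), (B.advance (r v)).weight i := by
  rcases rests_or_duels hn hi with h | ⟨a, b, ha, hb, hab, hw, ma, mb, h⟩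
  · simp [fun v => (h (r v)).1]
  have ha' := hp a ha
  have hb' := hp b hb
  rcases hw with ⟨rfl, hw⟩ | ⟨rfl, hw⟩
  · obtain ⟨c, hcb⟩ := hx b.1 (Ne.symm hab)
    -- The default `0` stands for a missing commitment. In that case the opponent reveals nothing,
    -- and `i` wins for every `v`.
    rw [hw, ma, ← sum_range_ite_mod_lt ha' hb' (c.getD 0)]
    refine Finset.sum_le_sum fun v hv => ?_
    rw [(h (r v)).1]
    have hva := revealed_eq_some (ho v) (hc v) (Finset.mem_range.1 hv)
    have hvb : (r v).revealed (duelModulus a b) b.1 = none ∨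
        (r v).revealed (duelModulus a b) b.1 = some (c.getD 0) := by
      refine (revealed_eq_none_or (r := r v) (i := b.1) _).imp_right ?_
      rintro ⟨u, hu, hu'⟩
      rw [hu', ← hcb v, hu]; rfl
    by_cases hm : (c.getD 0 + v) % duelModulus a b < (duelProb a b).num.toNat
    · rw [if_pos hm, if_pos (duelWinner_of_mod_lt hva hvb (by rwa [add_comm]))]
    · rw [if_neg hm]; split_ifs <;> positivity
  · obtain ⟨c, hca⟩ := hx a.1 hab
    rw [hw, mb, ← sum_range_ite_le_mod ha' hb' (c.getD 0)]
    refine Finset.sum_le_sum fun v hv => ?_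
    rw [(h (r v)).1]
    have hvb := revealed_eq_some (ho v) (hc v) (Finset.mem_range.1 hv)
    have hva : (r v).revealed (duelModulus a b) a.1 = none ∨
        (r v).revealed (duelModulus a b) a.1 = some (c.getD 0) := by
      refine (revealed_eq_none_or (r := r v) (i := a.1) _).imp_right ?_
      rintro ⟨u, hu, hu'⟩
      rw [hu', ← hca v, hu]; rfl
    by_cases hm : (c.getD 0 + v) % duelModulus a b < (duelProb a b).num.toNat
    · rw [if_pos hm]; split_ifs <;> positivity
    · rw [if_neg hm, if_pos (duelWinner_of_le_mod hvb hva hm)]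

/-- If all players follow the protocol, then the weight of each player is preserved on average
over its own random element. -/
theorem sum_weight_advance {B : Bracket (N × ℚ)} (hn : B.players.Nodup)
    (hp : ∀ a ∈ B.leaves, 0 < a.2) {i : N} (hi : i ∈ B.players) {r : ℕ → Phase N}
    (hc : ∀ v, (r v).commit i = some v) (ho : ∀ v x, (r v).opened x = true)
    (hx : ∀ x ∈ B.players, x ≠ i → ∃ c < B.modulus x, ∀ v, (r v).commit x = some c) :
    ∑ v ∈ Finset.range (B.modulus i), (B.advance (r v)).weight i =
      (B.modulus i : ℚ) * B.weight i := by
  rcases rests_or_duels hn hi with h | ⟨a, b, ha, hb, hab, hw, ma, mb, h⟩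
  · simp [fun v => (h (r v)).1]
  have ha' := hp a ha
  have hb' := hp b hb
  rcases hw with ⟨rfl, hw⟩ | ⟨rfl, hw⟩
  · obtain ⟨c, hcm, hcb⟩ := hx b.1 (List.mem_map_of_mem hb) (Ne.symm hab)
    rw [hw, ma, ← sum_range_ite_mod_lt ha' hb' c]
    refine Finset.sum_congr rfl fun v hv => ?_
    rw [(h (r v)).1]
    have hva := revealed_eq_some (ho v _) (hc v) (Finset.mem_range.1 hv)
    have hvb := revealed_eq_some (ho v _) (hcb v) (mb ▸ hcm)
    by_cases hm : (c + v) % duelModulus a b < (duelProb a b).num.toNat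
    · rw [if_pos hm, if_pos (duelWinner_of_mod_lt hva (.inr hvb) (by rwa [add_comm]))]
    · rw [if_neg hm, if_neg]
      rw [duelWinner_of_le_mod hvb (.inr hva) (by rwa [add_comm])]
      exact Ne.symm hab
  · obtain ⟨c, hcm, hca⟩ := hx a.1 (List.mem_map_of_mem ha) hab
    rw [hw, mb, ← sum_range_ite_le_mod ha' hb' c]
    refine Finset.sum_congr rfl fun v hv => ?_
    rw [(h (r v)).1]
    have hvb := revealed_eq_some (ho v _) (hc v) (Finset.mem_range.1 hv)
    have hva := revealed_eq_some (ho v _) (hca v) (ma ▸ hcm)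
    by_cases hm : (c + v) % duelModulus a b < (duelProb a b).num.toNat
    · rw [if_pos hm, if_neg]
      rw [duelWinner_of_mod_lt hva (.inr hvb) hm]
      exact hab
    · rw [if_neg hm, if_pos (duelWinner_of_le_mod hvb (.inr hva) hm)]

end Bracket

end OnlinePSVar

namespace OnlinePSVar

/-! ## Running the tournaments -/

variable {N M : Type*}

/-- Each player occurs at most once in a forest, and its weights are positive. -/
structure Forest.Proper (F : Forest N M) : Prop where
  nodup : ∀ j B, F j = some B → B.players.Nodup
  pos : ∀ j B, F j = some B → ∀ a ∈ B.leaves, 0 < a.2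
  disjoint : ∀ j j' B B', F j = some B → F j' = some B' → j ≠ j' → ∀ x ∈ B.players,
    x ∉ B'.players

theorem Forest.advance_eq_some {F : Forest N M} {r : Phase N} {j : M} {B' : Bracket (N × ℚ)} :
    F.advance r j = some B' ↔ ∃ B, F j = some B ∧ B.advance r = B' := by
  simp [Forest.advance, Option.map_eq_some_iff]

theorem Forest.Proper.advance {F : Forest N M} (hF : F.Proper) (r : Phase N) :
    (F.advance r).Proper where
  nodup j B' h := by
    obtain ⟨B, hB, rfl⟩ := Forest.advance_eq_some.1 h
    exact (hF.nodup j B hB).sublist (Bracket.players_advance_sublist r B)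
  pos j B' h := by
    obtain ⟨B, hB, rfl⟩ := Forest.advance_eq_some.1 h
    exact Bracket.pos_advance r (hF.pos j B hB)
  disjoint j j' B₁ B₂ h₁ h₂ hjj x hx hx' := by
    obtain ⟨B, hB, rfl⟩ := Forest.advance_eq_some.1 h₁
    obtain ⟨B', hB', rfl⟩ := Forest.advance_eq_some.1 h₂
    exact hF.disjoint j j' B B' hB hB' hjj x ((Bracket.players_advance_sublist r B).subset hx)
      ((Bracket.players_advance_sublist r B').subset hx')

variable [DecidableEq N] [Fintype M]

theorem Forest.Proper.modulus_eq {F : Forest N M} (hF : F.Proper) {j : M} {B : Bracket (N × ℚ)}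
    (hB : F j = some B) {i : N} (hi : i ∈ B.players) : F.modulus i = B.modulus i := by
  have h1 := Bracket.one_le_modulus i B
  refine le_antisymm (max_le h1 (Finset.sup_le fun j' _ => ?_)) (le_max_of_le_right ?_)
  · cases h : F j' with
    | none => exact h1
    | some B' =>
      by_cases hjj : j = j'
      · subst hjj; rw [hB] at h; cases h; exact le_rfl
      · have := hF.disjoint j j' B B' hB h hjj i hi
        simpa [Bracket.modulus_eq_one this] using h1
  · have := Finset.le_sup (f := fun j => (F j).elim 1 (Bracket.modulus i)) (Finset.mem_univ j)
    simpa [hB] using this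

theorem Forest.Proper.notMem_caught {F : Forest N M} (hF : F.Proper) {r : Phase N} {i : N}
    (ho : r.opened i = true) (hc : ∃ v < F.modulus i, r.commit i = some v) :
    i ∉ F.caught r := by
  intro h
  simp only [Forest.caught, Finset.mem_biUnion, Finset.mem_univ, true_and] at h
  obtain ⟨j, hj⟩ := h
  cases hB : F j with
  | none => simp [hB] at hj
  | some B =>
    simp only [hB, Option.elim_some] at hj
    have hi := Bracket.mem_players_of_mem_caught hj
    obtain ⟨v, hv, hc⟩ := hc
    rw [hF.modulus_eq hB hi] at hv
    rcases Bracket.rests_or_duels (hF.nodup j B hB) hi with h | ⟨a, b, -, -, -, hw, ma, mb, h⟩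
    · exact (h r).2 hj
    · have : B.modulus i = duelModulus a b := by
        rcases hw with ⟨rfl, -⟩ | ⟨rfl, -⟩ <;> assumption
      have h2 := (h r).2 hj
      rw [revealed_eq_some ho hc (this ▸ hv)] at h2
      cases h2

variable [Fintype N]

theorem Forest.mem_samples {F : Forest N M} {s : N → ℕ} :
    s ∈ F.samples ↔ ∀ i, s i < F.modulus i := by
  simp [Forest.samples, Fintype.mem_piFinset]

/-- Hiding makes the adversary's commitments independent of the honest elements of the same phase.
They can therefore be drawn first, and the honest elements averaged with them fixed. -/
theorem expect_playPhase (C : Finset N) (adv : Adversary N) (F : Forest N M)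
    (past : List (Phase N)) (f : Phase N → ℝ≥0∞) :
    (playPhase C adv F past).expect f = (adv.commit past).expect fun a =>
      (PMF.uniformOfFinset F.samples F.samples_nonempty).expect fun s =>
        (adv.opening past fun i => if i ∈ C then a i else some (s i)).expect fun b =>
          f ⟨fun i => if i ∈ C then a i else some (s i), fun i => if i ∈ C then b i else true⟩ := by
  rw [playPhase, PMF.bind_comm]
  simp only [PMF.expect_bind, PMF.expect_pure]

theorem expect_playPhase_honest (F : Forest N M) (past : List (Phase N)) (f : Phase N → ℝ≥0∞) :
    (playPhase ∅ (Adversary.silent N) F past).expect f =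
      (PMF.uniformOfFinset F.samples F.samples_nonempty).expect fun s =>
        f ⟨fun i => some (s i), fun _ => true⟩ := by
  rw [expect_playPhase]
  simp [Adversary.silent, PMF.expect_pure]

theorem mem_support_playPhase {C : Finset N} {adv : Adversary N} {F : Forest N M}
    {past : List (Phase N)} {r : Phase N} (hr : r ∈ (playPhase C adv F past).support) {i : N}
    (hi : i ∉ C) : r.opened i = true ∧ ∃ v < F.modulus i, r.commit i = some v := by
  simp only [playPhase, PMF.mem_support_bind_iff, PMF.mem_support_uniformOfFinset_iff,
    PMF.support_pure, Set.mem_singleton_iff, Forest.mem_samples] at hr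
  obtain ⟨s, hs, a, -, b, -, rfl⟩ := hr
  simp [hi, hs]

/-- Each phase lowers the depth of a tree by at least one until it is a leaf, while its total weight
is unchanged. Honest players always open an element in range, so they are never caught. -/
theorem support_playTournaments {C : Finset N} {adv : Adversary N} {f : ℕ} :
    ∀ {o o' : Outcome N M}, o' ∈ (playTournaments C adv f o).support → o.forest.Proper →
      (∀ j B, o.forest j = some B → B.depth ≤ f) →
      (∀ j, o.forest j = none → o'.forest j = none) ∧
      (∀ j B, o.forest j = some B → ∃ x ∈ B.players, o'.forest j = some (.leaf (x, B.total))) ∧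
      ∀ i ∉ C, i ∉ o.caught → i ∉ o'.caught := by
  induction f with
  | zero =>
    intro o o' h hF hd
    simp only [playTournaments, PMF.support_pure, Set.mem_singleton_iff] at h
    subst h
    refine ⟨fun j h => h, fun j B h => ?_, fun i _ h => h⟩
    have := hd j B h
    cases B with
    | leaf a => exact ⟨a.1, by simp, by simp [h]⟩
    | duel s t => simp [Bracket.depth] at this
  | succ f ih =>
    intro o o' h hF hd
    simp only [playTournaments, PMF.mem_support_bind_iff] at h
    obtain ⟨r, hr, h⟩ := h
    obtain ⟨h1, h2, h3⟩ := ih h (hF.advance r) (by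
      intro j B' hB'
      obtain ⟨B, hB, rfl⟩ := Forest.advance_eq_some.1 hB'
      have := hd j B hB
      have := Bracket.depth_advance_le r B
      omega)
    refine ⟨fun j hj => h1 j (by simp [Forest.advance, hj]), fun j B hB => ?_, fun i hi ho => ?_⟩
    · obtain ⟨x, hx, hx'⟩ := h2 j (B.advance r) (by simp [Forest.advance, hB])
      rw [Bracket.total_advance] at hx'
      exact ⟨x, (Bracket.players_advance_sublist r B).subset hx, hx'⟩
    · refine h3 i hi ?_
      have := mem_support_playPhase hr hi
      simpa [ho] using hF.notMem_caught this.1 this.2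

/-! ### The weight of an honest player -/

/-- Weights as extended nonnegative reals. -/
noncomputable def toENNReal (q : ℚ) : ℝ≥0∞ := ENNReal.ofReal (q : ℝ)

@[simp] theorem toENNReal_zero : toENNReal 0 = 0 := by simp [toENNReal]
@[simp] theorem toENNReal_one : toENNReal 1 = 1 := by simp [toENNReal]

theorem toENNReal_ne_top (q : ℚ) : toENNReal q ≠ ⊤ := ENNReal.ofReal_ne_top

theorem toENNReal_mul {p q : ℚ} (hp : 0 ≤ p) : toENNReal (p * q) = toENNReal p * toENNReal q := by
  simp [toENNReal, ENNReal.ofReal_mul (Rat.cast_nonneg.2 hp)]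

theorem toENNReal_mono {p q : ℚ} (h : p ≤ q) : toENNReal p ≤ toENNReal q :=
  ENNReal.ofReal_le_ofReal (Rat.cast_le.2 h)

theorem toENNReal_natCast (k : ℕ) : toENNReal k = k := by simp [toENNReal]

theorem toENNReal_add {p q : ℚ} (hp : 0 ≤ p) (hq : 0 ≤ q) :
    toENNReal (p + q) = toENNReal p + toENNReal q := by
  simp [toENNReal, ENNReal.ofReal_add (Rat.cast_nonneg.2 hp) (Rat.cast_nonneg.2 hq)]

theorem toENNReal_sum {ι : Type*} {s : Finset ι} {f : ι → ℚ} (h : ∀ i ∈ s, 0 ≤ f i) :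
    toENNReal (∑ i ∈ s, f i) = ∑ i ∈ s, toENNReal (f i) := by
  simp only [toENNReal, Rat.cast_sum]
  exact ENNReal.ofReal_sum_of_nonneg fun i hi => Rat.cast_nonneg.2 (h i hi)

/-- The weight of player `i` in the tournament for an item. -/
noncomputable def treeWeight (i : N) (T : Option (Bracket (N × ℚ))) : ℝ≥0∞ :=
  T.elim 0 fun B => toENNReal (B.weight i)

theorem le_expect_uniform {ι : Type*} {s : Finset ι} (hs : s.Nonempty) {f : ι → ℝ≥0∞}
    {c : ℝ≥0∞} (h : s.card * c ≤ ∑ a ∈ s, f a) : c ≤ (PMF.uniformOfFinset s hs).expect f := by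
  rw [PMF.expect_uniformOfFinset]
  have h0 : (s.card : ℝ≥0∞) ≠ 0 := by simpa using hs.ne_empty
  calc c = (s.card : ℝ≥0∞)⁻¹ * (s.card * c) := by
        rw [← mul_assoc, ENNReal.inv_mul_cancel h0 (ENNReal.natCast_ne_top _), one_mul]
    _ ≤ _ := by gcongr

/-- With the commitments and the elements of the other players fixed, only the element of `i` is
averaged. A rushing adversary may let the openings depend on it; this is harmless, since
`Bracket.le_sum_weight_advance` allows a separate opening pattern for every value. -/
theorem treeWeight_le_expect_playPhase {C : Finset N} {adv : Adversary N} {F : Forest N M}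
    (hF : F.Proper) {past : List (Phase N)} {i : N} (hi : i ∉ C) (j : M) :
    treeWeight i (F j) ≤
      (playPhase C adv F past).expect fun r => treeWeight i (F.advance r j) := by
  cases hB : F j with
  | none => simp [treeWeight]
  | some B =>
    by_cases hiB : i ∈ B.players
    swap
    · simp [treeWeight, Bracket.weight_eq_zero hiB]
    rw [expect_playPhase]
    conv_lhs => rw [← PMF.expect_const (adv.commit past) (treeWeight i _)]
    refine PMF.expect_mono fun a _ => ?_
    simp only [Forest.advance, hB, Option.map_some, treeWeight, Option.elim_some]
    refine le_expect_uniform _ ?_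
    rw [← nsmul_eq_mul, ← Finset.sum_const]
    refine sum_piFinset_le_of_coordinate _ i _ _ fun s hs => ?_
    have hm := hF.modulus_eq hB hiB
    -- the worst opening for each value of the random element of `i`
    have key : ∀ v, ∃ b : N → Bool, toENNReal ((B.advance ⟨fun x => if x ∈ C then a x else
        some (Function.update s i v x), fun x => if x ∈ C then b x else true⟩).weight i) ≤
        (adv.opening past fun x => if x ∈ C then a x else some (Function.update s i v x)).expect
        fun b => toENNReal ((B.advance ⟨fun x => if x ∈ C then a x else
        some (Function.update s i v x), fun x => if x ∈ C then b x else true⟩).weight i) := by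
      intro v
      obtain ⟨b, hb⟩ := Finite.exists_min fun b : N → Bool =>
        toENNReal ((B.advance ⟨fun x => if x ∈ C then a x else
        some (Function.update s i v x), fun x => if x ∈ C then b x else true⟩).weight i)
      refine ⟨b, ?_⟩
      conv_lhs => rw [← PMF.expect_const (adv.opening past fun x => if x ∈ C then a x else
        some (Function.update s i v x)) (toENNReal _)]
      exact PMF.expect_mono fun b' _ => hb b'
    choose b hb using key
    refine le_trans ?_ (Finset.sum_le_sum fun v _ => hb v)
    have hp := hF.pos j B hB
    rw [← toENNReal_sum fun v _ => Bracket.weight_nonneg (Bracket.pos_advance _ hp) i]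
    have h := Bracket.le_sum_weight_advance (hF.nodup j B hB) hp hiB
      (r := fun v => ⟨fun x => if x ∈ C then a x else
        some (Function.update s i v x), fun x => if x ∈ C then b v x else true⟩)
      (by simp [hi]) (by simp [hi]) (fun x hx => ⟨if x ∈ C then a x else some (s x), by simp [hx]⟩)
    rw [Finset.sum_const, Finset.card_range, hm, nsmul_eq_mul, ← toENNReal_natCast,
      ← toENNReal_mul (by positivity)]
    exact toENNReal_mono h

theorem treeWeight_le_expect {C : Finset N} {adv : Adversary N} {i : N} (hi : i ∉ C) (j : M)
    {f : ℕ} : ∀ {o : Outcome N M}, o.forest.Proper →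
    treeWeight i (o.forest j) ≤
      (playTournaments C adv f o).expect fun o' => treeWeight i (o'.forest j) := by
  induction f with
  | zero => intro o _; simp [playTournaments, PMF.expect_pure]
  | succ f ih =>
    intro o hF
    rw [playTournaments, PMF.expect_bind]
    exact (treeWeight_le_expect_playPhase hF hi j).trans
      (PMF.expect_mono fun r _ => ih (o := ⟨o.forest.advance r, _, _⟩) (hF.advance r))

/-! ### The joint law of the winners in the honest case -/

/-- The weight of the possible winner `x` in the tournament for an item; it is `1` if there is
neither a tournament nor a winner. -/
noncomputable def prizeWeight (x : Option N) (T : Option (Bracket (N × ℚ))) : ℝ≥0∞ :=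
  match x, T with
  | some i, T => treeWeight i T
  | none, none => 1
  | none, some _ => 0

/-- The trees are added one at a time. The random element of the player `w j` matters only in tree
`j`, so averaging over it preserves the factor of `j` in the mean and leaves the other factors
alone. If `w j` names no player of that tree, the factor is constant. -/
theorem sum_samples_prod_prizeWeight {F : Forest N M} (hF : F.Proper) (w : M → Option N)
    (J : Finset M) :
    ∑ s ∈ F.samples, ∏ j ∈ J, prizeWeight (w j) (F.advance ⟨fun i => some (s i), fun _ => true⟩ j) =
      F.samples.card * ∏ j ∈ J, prizeWeight (w j) (F j) := by
  classical
  induction J using Finset.induction_on with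
  | empty => simp
  | insert j J hj ih =>
    simp only [Finset.prod_insert hj]
    have const : (∀ s ∈ F.samples,
        prizeWeight (w j) (F.advance ⟨fun i => some (s i), fun _ => true⟩ j) =
        prizeWeight (w j) (F j)) → ∑ s ∈ F.samples,
        prizeWeight (w j) (F.advance ⟨fun i => some (s i), fun _ => true⟩ j) *
        ∏ j ∈ J, prizeWeight (w j) (F.advance ⟨fun i => some (s i), fun _ => true⟩ j) =
        F.samples.card * (prizeWeight (w j) (F j) * ∏ j ∈ J, prizeWeight (w j) (F j)) := by
      intro h
      rw [Finset.sum_congr rfl fun s hs => by rw [h s hs], ← Finset.mul_sum, ih]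
      ring
    cases hB : F j with
    | none => rw [← hB]; exact const fun s _ => by simp [Forest.advance, hB]
    | some B =>
    cases hw : w j with
    | none => rw [← hB, ← hw]; exact const fun s _ => by simp [Forest.advance, hB, hw, prizeWeight]
    | some x =>
    by_cases hx : x ∈ B.players
    swap
    · rw [← hB, ← hw]
      refine const fun s _ => ?_
      simp only [Forest.advance, hB, hw, prizeWeight, treeWeight, Option.map_some, Option.elim_some]
      rw [Bracket.weight_eq_zero hx, Bracket.weight_eq_zero fun h =>
        hx ((Bracket.players_advance_sublist _ B).subset h)]
    have hp := hF.pos j B hB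
    have hm := hF.modulus_eq hB hx
    have e : ∀ c : ℝ≥0∞, (F.samples.card : ℝ≥0∞) * (c * ∏ j ∈ J, prizeWeight (w j) (F j)) =
        ∑ s ∈ F.samples, c *
        ∏ j ∈ J, prizeWeight (w j) (F.advance ⟨fun i => some (s i), fun _ => true⟩ j) := by
      intro c; rw [← Finset.mul_sum, ih]; ring
    rw [e]
    refine sum_piFinset_eq_of_coordinate _ x _ _ fun s hs => ?_
    have hind : ∀ v, ∏ j ∈ J, prizeWeight (w j)
        (F.advance ⟨fun i => some (Function.update s x v i), fun _ => true⟩ j) =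
        ∏ j ∈ J, prizeWeight (w j) (F.advance ⟨fun i => some (s i), fun _ => true⟩ j) := by
      intro v
      refine Finset.prod_congr rfl fun j' hj' => ?_
      have hjj : j ≠ j' := fun h => hj (h ▸ hj')
      cases hB' : F j' with
      | none => simp [Forest.advance, hB']
      | some B' =>
        simp only [Forest.advance, hB', Option.map_some]
        congr 2
        refine Bracket.advance_congr fun y hy => ⟨?_, rfl⟩
        have : y ≠ x := fun h => hF.disjoint j j' B B' hB hB' hjj x hx (h ▸ hy)
        simp [this]
    simp only [hind, ← Finset.sum_mul, Finset.sum_const, Finset.card_range, nsmul_eq_mul]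
    congr 1
    simp only [Forest.advance, hB, Option.map_some, prizeWeight, treeWeight, Option.elim_some]
    rw [← toENNReal_sum fun v _ => Bracket.weight_nonneg (Bracket.pos_advance _ hp) x, hm,
      Bracket.sum_weight_advance (hF.nodup j B hB) hp hx
      (r := fun v => ⟨fun i => some (Function.update s x v i), fun _ => true⟩)
      (by simp) (by simp) (fun y hy hyx => ⟨s y, ?_, by simp [hyx]⟩),
      toENNReal_mul (by positivity), toENNReal_natCast]
    rw [← hF.modulus_eq hB hy]
    exact Forest.mem_samples.1 hs y

theorem expect_prod_prizeWeight (w : M → Option N) {f : ℕ} :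
    ∀ {o : Outcome N M}, o.forest.Proper →
    ((playTournaments ∅ (Adversary.silent N) f o).expect fun o' =>
      ∏ j, prizeWeight (w j) (o'.forest j)) = ∏ j, prizeWeight (w j) (o.forest j) := by
  induction f with
  | zero => intro o _; simp [playTournaments, PMF.expect_pure]
  | succ f ih =>
    intro o hF
    rw [playTournaments, PMF.expect_bind]
    rw [PMF.expect_congr fun r _ => ih (o := ⟨o.forest.advance r, _, _⟩) (hF.advance r),
      expect_playPhase_honest, PMF.expect_uniformOfFinset, sum_samples_prod_prizeWeight hF,
      ← mul_assoc, ENNReal.inv_mul_cancel _ (ENNReal.natCast_ne_top _), one_mul]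
    simpa using o.forest.samples_nonempty.ne_empty

/-- The winners of all tournaments. -/
def Outcome.winner (o : Outcome N M) (j : M) : Option N := (o.forest j).bind Bracket.champion

/-- If all players are honest, then the winners of the tournaments are independent, and each
player wins with probability equal to its weight. -/
theorem expect_winner [DecidableEq M] {o : Outcome N M} {f : ℕ} (hF : o.forest.Proper)
    (hd : ∀ j B, o.forest j = some B → B.depth ≤ f)
    (ht : ∀ j B, o.forest j = some B → B.total = 1) (g : (M → Option N) → ℝ≥0∞) :
    ((playTournaments ∅ (Adversary.silent N) f o).expect fun o' => g o'.winner) =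
      ∑ w : M → Option N, (∏ j, prizeWeight (w j) (o.forest j)) * g w := by
  -- At the end every tree is a leaf of weight `1`, so the product of the prize weights is the
  -- indicator of the event that `w` is the vector of winners. Its expectation is the initial
  -- product.
  have h : ∀ o' ∈ (playTournaments ∅ (Adversary.silent N) f o).support, g o'.winner =
      ∑ w : M → Option N, g w * ∏ j, prizeWeight (w j) (o'.forest j) := by
    intro o' ho'
    obtain ⟨h1, h2, -⟩ := support_playTournaments ho' hF hd
    have hw : ∀ w : M → Option N, ∏ j, prizeWeight (w j) (o'.forest j) =
        if w = o'.winner then 1 else 0 := by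
      intro w
      have hj : ∀ j, prizeWeight (w j) (o'.forest j) = if w j = o'.winner j then 1 else 0 := by
        intro j
        cases hB : o.forest j with
        | none =>
          have := h1 j hB
          cases hwj : w j <;> simp [this, prizeWeight, treeWeight, Outcome.winner]
        | some B =>
          obtain ⟨x, -, hx⟩ := h2 j B hB
          rw [ht j B hB] at hx
          cases hwj : w j with
          | none => simp [hx, prizeWeight, Outcome.winner, Bracket.champion]
          | some y =>
            simp only [hx, prizeWeight, treeWeight, Outcome.winner, Bracket.champion,
              Option.elim_some, Bracket.weight_leaf, Option.bind_some, Option.some.injEq]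
            rcases eq_or_ne x y with rfl | hxy
            · simp
            · simp [hxy, hxy.symm]
      simp only [hj]
      rw [Finset.prod_ite_zero]
      simp [funext_iff]
    simp [hw]
  rw [PMF.expect_congr h, PMF.expect_finsetSum]
  refine Finset.sum_congr rfl fun w _ => ?_
  rw [PMF.expect_const_mul, expect_prod_prizeWeight w hF, mul_comm]

end OnlinePSVar

namespace OnlinePSVar

/-! ## Invariants of the consumption process -/

namespace State

variable {n : ℕ} {N M : Type*} [Fintype N] [Fintype M] [DecidableEq M]

/-- The invariants of the process, where the players in `C` may be corrupted, that hold at all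
times. -/
structure Invariant (σ : Profile n N M) (C : Finset N) (st : State N M) : Prop where
  rate_nonneg : ∀ i, 0 ≤ st.rate i
  share_nonneg : ∀ i j, 0 ≤ st.share i j
  sum_share_le : ∀ j ∈ st.remaining, ∑ i, st.share i j ≤ 1
  consumes : ∀ i, ∀ j ∈ st.remaining, 0 < st.share i j → st.Consumes σ i j
  -- At most one summand is nonzero, the fraction of the current item. A player that starts on a new
  -- item at time `t` thus has rate `1 / (1 - t)`.
  balance : ∀ i, 0 < st.rate i → st.rate i * (1 - st.time) + ∑ j ∈ st.remaining, st.share i j = 1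
  rate_holder : ∀ i j, st.holder j = some i → st.rate i = 0
  holder_inj : ∀ j j' i, st.holder j = some i → st.holder j' = some i → j = j'
  held : ∀ j ∉ st.remaining, ∃ i, st.holder j = some i
  -- This is limited to players outside `C`: a player that is caught also gets rate `0`, but
  -- possibly no item.
  holds : ∀ i ∉ C, st.rate i = 0 → ∃ j ∉ st.remaining, st.holder j = some i
  consumed_le : (n - st.remaining.card : ℚ) + ∑ j ∈ st.remaining, ∑ i, st.share i j ≤ n * st.time

/-- The invariants that hold between two iterations of the main loop. -/
structure Between (σ : Profile n N M) (C : Finset N) (st : State N M) : Prop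
    extends st.Invariant σ C where
  sum_share_lt : ∀ j ∈ st.remaining, ∑ i, st.share i j < 1

/-- The invariants that hold when an item has just been totally consumed. -/
structure AtFinish (σ : Profile n N M) (C : Finset N) (st : State N M) : Prop
    extends st.Invariant σ C where
  share_pos : ∀ i j, st.Consumes σ i j → 0 < st.share i j
  finished_nonempty : st.finished.Nonempty

variable {σ : Profile n N M} {C : Finset N} {st : State N M}

theorem Consumes.unique {i : N} {j j' : M} (h : st.Consumes σ i j) (h' : st.Consumes σ i j') :
    j = j' :=
  (σ i).symm.injective (le_antisymm (h.2.2 _ h'.2.1) (h'.2.2 _ h.2.1))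

theorem between_init (hM : Fintype.card M = n) : (State.init N M).Between σ C where
  rate_nonneg _ := zero_le_one
  share_nonneg _ _ := le_rfl
  sum_share_le _ _ := by simp [init]
  consumes _ _ _ h := by simp [init] at h
  balance _ _ := by simp [init]
  rate_holder _ _ h := by simp [init] at h
  holder_inj _ _ _ h := by simp [init] at h
  held _ h := by simp [init] at h
  holds _ _ h := by simp [init] at h
  consumed_le := by simp [init, hM]
  sum_share_lt _ _ := by simp [init]

namespace Invariant

variable (h : st.Invariant σ C)
include h

/-- Each consumed item has a holder, which has rate `0`, and different items have different holders.
-/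
theorem card_alive_le (hN : Fintype.card N = n) (hM : Fintype.card M = n) :
    (Finset.univ.filter fun i => 0 < st.rate i).card ≤ st.remaining.card := by
  classical
  have h1 : (Finset.univ \ st.remaining).card ≤
      (Finset.univ.filter fun i => ¬ 0 < st.rate i).card := by
    have hex : ∀ j, ∃ i, j ∉ st.remaining → st.holder j = some i := fun j => by
      by_cases hj : j ∈ st.remaining
      · have : 0 < n := hM ▸ Fintype.card_pos_iff.2 ⟨j⟩
        obtain ⟨i⟩ := Fintype.card_pos_iff.1 (hN ▸ this)
        exact ⟨i, fun h => absurd hj h⟩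
      · exact (h.held j hj).imp fun i hi _ => hi
    choose p hp using hex
    refine Finset.card_le_card_of_injOn p ?_ ?_
    · intro j hj
      have hj' : j ∉ st.remaining := by simpa using hj
      simp [h.rate_holder _ _ (hp j hj')]
    · intro j hj j' hj' hjj
      have h1 : j ∉ st.remaining := by simpa using hj
      have h2 : j' ∉ st.remaining := by simpa using hj'
      exact h.holder_inj j j' (p j) (hp j h1) (hjj ▸ hp j' h2)
  have h2 := Finset.card_sdiff_add_card_eq_card (Finset.subset_univ st.remaining)
  have h3 := Finset.card_filter_add_card_filter_not (s := (Finset.univ : Finset N))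
    (fun i => 0 < st.rate i)
  rw [Finset.card_univ] at h2 h3
  omega

theorem exists_consumes (hN : Fintype.card N = n) (hM : Fintype.card M = n) {i : N}
    (hi : 0 < st.rate i) : ∃ j, st.Consumes σ i j := by
  have h1 := h.card_alive_le hN hM
  have h2 : 0 < (Finset.univ.filter fun i => 0 < st.rate i).card :=
    Finset.card_pos.2 ⟨i, by simpa using hi⟩
  obtain ⟨j, hj, hmin⟩ := Finset.exists_min_image st.remaining (σ i).symm
    (Finset.card_pos.1 (h2.trans_le h1))
  exact ⟨j, hi, hj, hmin⟩

theorem sum_share_of_consumes {i : N} {j : M} (hc : st.Consumes σ i j) :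
    ∑ j ∈ st.remaining, st.share i j = st.share i j := by
  refine Finset.sum_eq_single_of_mem j hc.2.1 fun j' hj' hne => ?_
  by_contra h0
  exact hne ((h.consumes i j' hj' (lt_of_le_of_ne (h.share_nonneg i j') (Ne.symm h0))).unique hc)

theorem balance_of_consumes {i : N} {j : M} (hc : st.Consumes σ i j) :
    st.rate i * (1 - st.time) = 1 - st.share i j := by
  have := h.balance i hc.1
  rw [h.sum_share_of_consumes hc] at this
  linarith

theorem share_le_one (i : N) {j : M} (hj : j ∈ st.remaining) : st.share i j ≤ 1 :=
  (Finset.single_le_sum (f := fun i => st.share i j) (fun k _ => h.share_nonneg k j)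
    (Finset.mem_univ i)).trans (h.sum_share_le j hj)

theorem time_le_one {i : N} {j : M} (hc : st.Consumes σ i j) : st.time ≤ 1 := by
  have h1 := h.balance_of_consumes hc
  have h2 := h.share_le_one i hc.2.1
  by_contra! h3
  have := mul_pos hc.1 (sub_pos.2 h3)
  linarith

/-- In the sum of `balance` over the players, each active player contributes `1` and the others `0`;
by `card_alive_le` there are at most as many active players as remaining items. -/
theorem sum_rate_mul_le (hN : Fintype.card N = n) (hM : Fintype.card M = n) :
    (∑ i, st.rate i) * (1 - st.time) + ∑ j ∈ st.remaining, ∑ i, st.share i j ≤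
      st.remaining.card := by
  rw [Finset.sum_comm, Finset.sum_mul, ← Finset.sum_add_distrib]
  have : ∀ i, st.rate i * (1 - st.time) + ∑ j ∈ st.remaining, st.share i j =
      if 0 < st.rate i then 1 else 0 := by
    intro i
    split_ifs with hi
    · exact h.balance i hi
    · have h0 : st.rate i = 0 := le_antisymm (not_lt.1 hi) (h.rate_nonneg i)
      rw [h0, zero_mul, zero_add]
      refine Finset.sum_eq_zero fun j hj => ?_
      by_contra hs
      exact hi (h.consumes i j hj (lt_of_le_of_ne (h.share_nonneg i j) (Ne.symm hs))).1
  rw [Finset.sum_congr rfl fun i _ => this i, ← Finset.sum_filter, Finset.sum_const, nsmul_eq_mul,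
    mul_one]
  exact_mod_cast h.card_alive_le hN hM

theorem sum_demand (hN : Fintype.card N = n) (hM : Fintype.card M = n) :
    ∑ j ∈ st.remaining, st.demand σ j = ∑ i, st.rate i := by
  simp only [demand, Finset.sum_filter]
  rw [Finset.sum_comm]
  refine Finset.sum_congr rfl fun i _ => ?_
  rcases (h.rate_nonneg i).eq_or_lt with hi | hi
  · rw [← hi]; simp
  · obtain ⟨j, hj⟩ := h.exists_consumes hN hM hi
    rw [Finset.sum_eq_single_of_mem j hj.2.1, if_pos hj]
    intro j' _ hne
    exact if_neg fun hj' => hne (hj'.unique hj)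

theorem demand_nonneg (j : M) : 0 ≤ st.demand σ j :=
  Finset.sum_nonneg fun i _ => h.rate_nonneg i

theorem demand_pos {i : N} {j : M} (hc : st.Consumes σ i j) : 0 < st.demand σ j :=
  hc.1.trans_le (Finset.single_le_sum (f := st.rate) (fun i _ => h.rate_nonneg i)
    (Finset.mem_filter.2 ⟨Finset.mem_univ i, hc⟩))

end Invariant

/-! ### Consumption up to the next finished item. -/

theorem mem_remaining_of_demand_pos {j : M} (hj : 0 < st.demand σ j) : j ∈ st.remaining := by
  obtain ⟨i, hi, -⟩ := Finset.exists_ne_zero_of_sum_ne_zero hj.ne'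
  exact (Finset.mem_filter.1 hi).2.2.1

theorem delay_le {j : M} (hj : 0 < st.demand σ j) :
    st.delay σ ≤ (1 - ∑ i, st.share i j) / st.demand σ j := by
  have hm : j ∈ Finset.univ.filter fun j => 0 < st.demand σ j := by simpa using hj
  rw [delay, dif_pos ⟨j, hm⟩]
  exact Finset.inf'_le _ hm

theorem exists_delay_eq {j : M} (hj : 0 < st.demand σ j) :
    ∃ j, 0 < st.demand σ j ∧ st.delay σ = (1 - ∑ i, st.share i j) / st.demand σ j := by
  have hm : j ∈ Finset.univ.filter fun j => 0 < st.demand σ j := by simpa using hj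
  rw [delay, dif_pos ⟨j, hm⟩]
  obtain ⟨j', hj', he⟩ := Finset.exists_mem_eq_inf' ⟨j, hm⟩
    fun j => (1 - ∑ i, st.share i j) / st.demand σ j
  exact ⟨j', by simpa using hj', he⟩

theorem sum_share_consume (j : M) : ∑ i, (st.consume σ).share i j =
    ∑ i, st.share i j + st.demand σ j * st.delay σ := by
  simp only [consume, Finset.sum_add_distrib, ← Finset.sum_filter, demand, Finset.sum_mul]

theorem consumes_consume {i : N} {j : M} :
    (st.consume σ).Consumes σ i j ↔ st.Consumes σ i j := Iff.rfl

theorem Between.atFinish (h : st.Between σ C) (hN : Fintype.card N = n)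
    (hM : Fintype.card M = n) (ha : ∃ i, 0 < st.rate i) : (st.consume σ).AtFinish σ C := by
  obtain ⟨i₀, hi₀⟩ := ha
  obtain ⟨j₀, hj₀⟩ := h.exists_consumes hN hM hi₀
  -- `j₁` attains the minimum that defines the delay, so it will be finished; the delay is positive
  -- because no remaining item was totally consumed before.
  obtain ⟨j₁, hj₁, he⟩ := exists_delay_eq (h.demand_pos hj₀)
  have hj₁r := mem_remaining_of_demand_pos hj₁
  have hd : 0 < st.delay σ := by
    rw [he]; exact div_pos (sub_pos.2 (h.sum_share_lt j₁ hj₁r)) hj₁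
  have hle : ∀ j ∈ st.remaining, ∑ i, (st.consume σ).share i j ≤ 1 := fun j hj => by
    rw [sum_share_consume]
    rcases (h.demand_nonneg j).eq_or_lt with h0 | h0
    · rw [← h0, zero_mul, add_zero]; exact (h.sum_share_lt j hj).le
    · have := (le_div_iff₀ h0).1 (delay_le h0)
      linarith
  have hnn : ∀ i j, st.share i j ≤ (st.consume σ).share i j := fun i j => by
    simp only [consume, le_add_iff_nonneg_right]
    split_ifs
    · exact mul_nonneg (h.rate_nonneg i) hd.le
    · exact le_rfl
  have hcon : ∀ i, ∀ j ∈ st.remaining, 0 < (st.consume σ).share i j → st.Consumes σ i j := by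
    intro i j hj hs
    simp only [consume] at hs
    split_ifs at hs with hc
    · exact hc
    · exact h.consumes i j hj (by simpa using hs)
  have hbal : ∀ i, 0 < st.rate i → st.rate i * (1 - (st.consume σ).time) +
      ∑ j ∈ st.remaining, (st.consume σ).share i j = 1 := by
    intro i hi
    obtain ⟨j, hj⟩ := h.exists_consumes hN hM hi
    have : ∑ j ∈ st.remaining, (st.consume σ).share i j =
        ∑ j ∈ st.remaining, st.share i j + st.rate i * st.delay σ := by
      simp only [consume, Finset.sum_add_distrib]
      congr 1
      rw [Finset.sum_eq_single_of_mem j hj.2.1, if_pos hj]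
      intro j' _ hne
      exact if_neg fun hj' => hne (hj'.unique hj)
    rw [this]
    have := h.balance i hi
    simp only [consume]
    linarith
  have htime : st.time + st.delay σ ≤ 1 := by
    have h1 := hbal i₀ hi₀
    have h2 : ∑ j ∈ st.remaining, (st.consume σ).share i₀ j = (st.consume σ).share i₀ j₀ := by
      refine Finset.sum_eq_single_of_mem j₀ hj₀.2.1 fun j' hj' hne => ?_
      by_contra h0
      exact hne ((hcon i₀ j' hj' (lt_of_le_of_ne ((h.share_nonneg _ _).trans (hnn _ _))
        (Ne.symm h0))).unique hj₀)
    have h3 : (st.consume σ).share i₀ j₀ ≤ 1 :=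
      (Finset.single_le_sum (f := fun i => (st.consume σ).share i j₀)
        (fun k _ => (h.share_nonneg _ _).trans (hnn _ _)) (Finset.mem_univ i₀)).trans
        (hle j₀ hj₀.2.1)
    rw [h2] at h1
    change st.rate i₀ * (1 - (st.time + st.delay σ)) + _ = 1 at h1
    by_contra! h4
    have := mul_pos hi₀ (sub_pos.2 h4)
    linarith
  exact
  { rate_nonneg := h.rate_nonneg
    share_nonneg := fun i j => (h.share_nonneg i j).trans (hnn i j)
    sum_share_le := hle
    consumes := hcon
    balance := hbal
    rate_holder := h.rate_holder
    holder_inj := h.holder_inj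
    held := h.held
    holds := h.holds
    consumed_le := by
      have h1 := h.sum_rate_mul_le hN hM
      have h2 := h.consumed_le
      have h3 : ∑ j ∈ st.remaining, ∑ i, (st.consume σ).share i j =
          ∑ j ∈ st.remaining, ∑ i, st.share i j + (∑ i, st.rate i) * st.delay σ := by
        simp only [sum_share_consume, Finset.sum_add_distrib, ← Finset.sum_mul,
          h.sum_demand hN hM]
      change (n - st.remaining.card : ℚ) + ∑ j ∈ st.remaining, ∑ i, (st.consume σ).share i j ≤
        n * (st.time + st.delay σ)
      rw [h3]
      generalize ∑ j ∈ st.remaining, ∑ i, st.share i j = c at *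
      generalize ∑ i, st.rate i = s at *
      generalize st.delay σ = d at *
      generalize (st.remaining.card : ℚ) = m at *
      generalize st.time = t at *
      have ht : 0 < 1 - t := by linarith
      -- The consumed amount `q = n - m + c` becomes `q + s d`. By `s (1 - t) ≤ m - c` and `q ≤ n
      -- t`, multiplying by `1 - t` gives at most `q (1 - t - d) + n d ≤ n t (1 - t - d) + n d = n
      -- (t + d) (1 - t)`.
      refine le_of_mul_le_mul_right ?_ ht
      nlinarith [mul_le_mul_of_nonneg_left h1 hd.le,
        mul_le_mul_of_nonneg_right h2 (show 0 ≤ 1 - t - d by linarith)]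
    share_pos := by
      intro i j hc
      have hc' : st.Consumes σ i j := hc
      simp only [consume, if_pos hc']
      exact add_pos_of_nonneg_of_pos (h.share_nonneg i j) (mul_pos hc'.1 hd)
    finished_nonempty := by
      refine ⟨j₁, Finset.mem_filter.2 ⟨hj₁r, ?_⟩⟩
      rw [sum_share_consume, he, mul_div_cancel₀ _ hj₁.ne']
      ring }

/-! ### The update after the tournaments -/

section Update

variable [DecidableEq N] {o : Outcome N M}

theorem mem_finished {j : M} : j ∈ st.finished ↔ j ∈ st.remaining ∧ ∑ i, st.share i j = 1 :=
  Finset.mem_filter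

theorem mem_candidates {i : N} {j : M} : i ∈ st.candidates j ↔ 0 < st.share i j := by
  simp [candidates]

theorem holder_update (j : M) :
    (st.update o).holder j = if j ∈ st.finished then o.winner j else st.holder j := rfl

theorem rate_update (i : N) : (st.update o).rate i =
    if ∃ j ∈ st.finished, i ∈ st.candidates j ∧ (o.winner j = some i ∨ i ∈ o.caught) then 0
      else st.rate i + ∑ j ∈ st.finished with i ∈ st.candidates j, st.bonus j (o.winner j) i := rfl

theorem Invariant.consumes_of_candidate (h : st.Invariant σ C) {i : N} {j : M}
    (hj : j ∈ st.finished) (hi : i ∈ st.candidates j) : st.Consumes σ i j :=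
  h.consumes i j (mem_finished.1 hj).1 (mem_candidates.1 hi)

theorem Invariant.candidates_nonempty (h : st.Invariant σ C) {j : M}
    (hj : j ∈ st.finished) : (st.candidates j).Nonempty := by
  have h1 := (mem_finished.1 hj).2
  obtain ⟨i, -, hi⟩ := Finset.exists_ne_zero_of_sum_ne_zero (h1.trans_ne one_ne_zero)
  exact ⟨i, mem_candidates.2 (lt_of_le_of_ne (h.share_nonneg i j) (Ne.symm hi))⟩

theorem rate_update_of_not_candidate {i : N} (hi : ∀ j ∈ st.finished, i ∉ st.candidates j) :
    (st.update o).rate i = st.rate i := by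
  rw [rate_update, if_neg (by rintro ⟨j, hj, hj', -⟩; exact hi j hj hj'),
    Finset.filter_eq_empty_iff.2 fun j hj => hi j hj]
  simp

theorem rate_update_of_winner {i : N} {j : M} (hj : j ∈ st.finished) (hi : i ∈ st.candidates j)
    (hw : o.winner j = some i) : (st.update o).rate i = 0 := by
  rw [rate_update, if_pos ⟨j, hj, hi, .inl hw⟩]

/-- Let `p` and `q` be the fractions of `i` and of the winner. By `balance` the old rate of `i` is
`(1 - p) / (1 - t)` and that of the winner is `(1 - q) / (1 - t)`. The other candidates consumed `1
- q` in total, so the bonus is `p / (1 - t)`, and the new rate is `1 / (1 - t)`. -/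
theorem Invariant.rate_update_mul (h : st.Invariant σ C) {i x : N} {j : M} (hj : j ∈ st.finished)
    (hi : i ∈ st.candidates j) (hx : x ∈ st.candidates j) (hw : o.winner j = some x)
    (hix : i ≠ x) (hc : i ∉ o.caught) :
    0 < 1 - st.time ∧ (st.update o).rate i * (1 - st.time) = 1 := by
  have hci := h.consumes_of_candidate hj hi
  have hcx := h.consumes_of_candidate hj hx
  have huniq : ∀ j' ∈ st.finished, i ∈ st.candidates j' → j' = j := fun j' hj' hi' =>
    (h.consumes_of_candidate hj' hi').unique hci
  have hbi := h.balance_of_consumes hci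
  have hbx := h.balance_of_consumes hcx
  have hsi := mem_candidates.1 hi
  have hsum : ∑ k ∈ (st.candidates j).erase x, st.share k j = 1 - st.share x j := by
    have h1 : ∑ k ∈ st.candidates j, st.share k j = 1 := by
      rw [← (mem_finished.1 hj).2]
      refine Finset.sum_subset (Finset.subset_univ _) fun k _ hk => ?_
      exact le_antisymm (not_lt.1 fun h' => hk (mem_candidates.2 h')) (h.share_nonneg k j)
    rw [← h1, ← Finset.add_sum_erase _ _ hx]
    ring
  have hpos : 0 < 1 - st.share x j := by
    rw [← hsum]
    exact hsi.trans_le (Finset.single_le_sum (f := fun k => st.share k j)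
      (fun k _ => h.share_nonneg k j) (Finset.mem_erase.2 ⟨hix, hi⟩))
  have ht : 0 < 1 - st.time := by
    rw [← hbx] at hpos
    exact pos_of_mul_pos_right hpos hcx.1.le
  refine ⟨ht, ?_⟩
  rw [rate_update, if_neg]
  · have : st.finished.filter (fun j => i ∈ st.candidates j) = {j} := by
      ext j'
      simp only [Finset.mem_filter, Finset.mem_singleton]
      exact ⟨fun h => huniq j' h.1 h.2, by rintro rfl; exact ⟨hj, hi⟩⟩
    rw [this, Finset.sum_singleton, hw]
    simp only [bonus, hsum]
    rw [add_mul, hbi, ← hbx]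
    have := hcx.1.ne'
    have := ht.ne'
    field_simp
    ring
  · rintro ⟨j', hj', hi', h1 | h1⟩
    · rw [huniq j' hj' hi', hw] at h1
      exact hix (Option.some_injective _ h1).symm
    · exact hc h1

theorem AtFinish.update (h : st.AtFinish σ C)
    (hw : ∀ j ∈ st.finished, ∃ x ∈ st.candidates j, o.winner j = some x)
    (hc : ∀ i ∉ C, i ∉ o.caught) : (st.update o).Between σ C := by
  have hsub : st.finished ⊆ st.remaining := Finset.filter_subset _ _
  have hrem : ∀ j, j ∈ (st.update o).remaining ↔ j ∈ st.remaining ∧ j ∉ st.finished := fun j =>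
    Finset.mem_sdiff
  -- A candidate for a finished item has consumed nothing of the remaining items, so it starts
  -- afresh after the tournament.
  have hshare : ∀ i j, i ∈ st.candidates j → j ∈ st.finished →
      ∀ j' ∈ (st.update o).remaining, st.share i j' = 0 := by
    intro i j hi hj j' hj'
    by_contra h0
    have h1 := h.consumes i j' ((hrem j').1 hj').1
      (lt_of_le_of_ne (h.share_nonneg i j') (Ne.symm h0))
    have := h1.unique (h.consumes_of_candidate hj hi)
    exact ((hrem j').1 hj').2 (this ▸ hj)
  have halive : ∀ i, 0 < (st.update o).rate i ∨ (st.update o).rate i = 0 := by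
    intro i
    by_cases hi : ∃ j ∈ st.finished, i ∈ st.candidates j
    · obtain ⟨j, hj, hi⟩ := hi
      by_cases hci : i ∈ o.caught
      · right; rw [rate_update, if_pos ⟨j, hj, hi, .inr hci⟩]
      · obtain ⟨x, hx, hwx⟩ := hw j hj
        by_cases hix : i = x
        · right; exact rate_update_of_winner hj hi (hix ▸ hwx)
        · left
          obtain ⟨ht, hr⟩ := Invariant.rate_update_mul h.toInvariant hj hi hx hwx hix hci
          exact pos_of_mul_pos_left (hr.symm ▸ zero_lt_one) ht.le
    · push Not at hi
      rw [rate_update_of_not_candidate hi]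
      exact (h.rate_nonneg i).lt_or_eq.imp id Eq.symm
  exact
  { rate_nonneg := fun i => (halive i).elim le_of_lt fun h => h.ge
    share_nonneg := h.share_nonneg
    sum_share_le := fun j hj => h.sum_share_le j ((hrem j).1 hj).1
    sum_share_lt := fun j hj => lt_of_le_of_ne (h.sum_share_le j ((hrem j).1 hj).1) fun h1 =>
      ((hrem j).1 hj).2 (mem_finished.2 ⟨((hrem j).1 hj).1, h1⟩)
    consumes := by
      intro i j hj hs
      have h1 := h.consumes i j ((hrem j).1 hj).1 hs
      refine ⟨?_, hj, fun j' hj' => h1.2.2 j' ((hrem j').1 hj').1⟩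
      rw [rate_update_of_not_candidate]
      · exact h1.1
      · intro j' hj' hi
        exact hs.ne' (hshare i j' hi hj' j hj)
    balance := by
      intro i hr
      change _ * (1 - st.time) + ∑ j ∈ (st.update o).remaining, st.share i j = 1
      by_cases hi : ∃ j ∈ st.finished, i ∈ st.candidates j
      · obtain ⟨j, hj, hi⟩ := hi
        rw [Finset.sum_eq_zero fun j' hj' => hshare i j hi hj j' hj', add_zero]
        obtain ⟨x, hx, hwx⟩ := hw j hj
        refine (Invariant.rate_update_mul h.toInvariant hj hi hx hwx ?_ ?_).2
        · rintro rfl; exact hr.ne' (rate_update_of_winner hj hi hwx)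
        · intro hci
          rw [rate_update, if_pos ⟨j, hj, hi, .inr hci⟩] at hr
          exact hr.false
      · push Not at hi
        rw [rate_update_of_not_candidate hi] at hr ⊢
        refine Eq.trans ?_ (h.balance i hr)
        rw [add_right_inj]
        refine Finset.sum_subset Finset.sdiff_subset fun j hj hj' => ?_
        have hjf : j ∈ st.finished := by
          by_contra hjf; exact hj' ((hrem j).2 ⟨hj, hjf⟩)
        exact le_antisymm (not_lt.1 fun h' => hi j hjf (mem_candidates.2 h')) (h.share_nonneg i j)
    rate_holder := by
      intro i j hh
      rw [holder_update] at hh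
      split_ifs at hh with hj
      · obtain ⟨x, hx, hwx⟩ := hw j hj
        obtain rfl : x = i := Option.some_injective _ (hwx.symm.trans hh)
        exact rate_update_of_winner hj hx hwx
      · have h0 := h.rate_holder i j hh
        rw [rate_update_of_not_candidate, h0]
        intro j' hj' hi
        exact (h.consumes_of_candidate hj' hi).1.ne' h0
    holder_inj := by
      have key : ∀ j ∈ st.finished, ∀ i, o.winner j = some i → st.Consumes σ i j := by
        intro j hj i hh
        obtain ⟨x, hx, hwx⟩ := hw j hj
        obtain rfl : x = i := Option.some_injective _ (hwx.symm.trans hh)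
        exact h.consumes_of_candidate hj hx
      intro j j' i hh hh'
      rw [holder_update] at hh hh'
      split_ifs at hh hh' with hj hj' hj'
      · exact (key j hj i hh).unique (key j' hj' i hh')
      · exact absurd (h.rate_holder i j' hh') (key j hj i hh).1.ne'
      · exact absurd (h.rate_holder i j hh) (key j' hj' i hh').1.ne'
      · exact h.holder_inj j j' i hh hh'
    held := by
      intro j hj
      rw [holder_update]
      split_ifs with hjf
      · obtain ⟨x, -, hwx⟩ := hw j hjf
        exact ⟨x, hwx⟩
      · exact h.held j fun hj' => hj ((hrem j).2 ⟨hj', hjf⟩)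
    holds := by
      intro i hiC hr
      by_cases hi : ∃ j ∈ st.finished, i ∈ st.candidates j
      · obtain ⟨j, hj, hi⟩ := hi
        obtain ⟨x, hx, hwx⟩ := hw j hj
        refine ⟨j, fun h' => ((hrem j).1 h').2 hj, ?_⟩
        rw [holder_update, if_pos hj, hwx]
        -- An honest loser would have the nonzero rate `1 / (1 - t)`.
        by_contra hne
        have := (Invariant.rate_update_mul h.toInvariant hj hi hx hwx
          (fun h' => hne (h' ▸ rfl)) (hc i hiC)).2
        rw [hr, zero_mul] at this
        exact zero_ne_one this
      · push Not at hi
        rw [rate_update_of_not_candidate hi] at hr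
        obtain ⟨j, hj, hh⟩ := h.holds i hiC hr
        refine ⟨j, fun h' => hj ((hrem j).1 h').1, ?_⟩
        rwa [holder_update, if_neg fun h' => hj (hsub h')]
    consumed_le := by
      -- Each finished item moves from the sum of fractions, where it counts `1`, to the number of
      -- consumed items.
      refine le_trans (le_of_eq ?_) h.consumed_le
      have h1 : ∑ j ∈ st.finished, ∑ i, st.share i j = st.finished.card := by
        rw [Finset.sum_congr rfl fun j hj => (mem_finished.1 hj).2]
        simp
      have h2 := Finset.sum_sdiff (f := fun j => ∑ i, st.share i j) hsub
      have h3 := Finset.card_sdiff_add_card_eq_card hsub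
      have h4 : ((st.remaining \ st.finished).card : ℚ) + st.finished.card = st.remaining.card := by
        exact_mod_cast h3
      change (n - (st.remaining \ st.finished).card : ℚ) +
        ∑ j ∈ st.remaining \ st.finished, ∑ i, st.share i j = _
      linarith }

end Update

end State

end OnlinePSVar

namespace OnlinePSVar

variable {n : ℕ} {N M : Type*} [Fintype N] [DecidableEq N] [Fintype M] [DecidableEq M]

/-! ## The tournaments of the main loop -/

namespace Rules

variable (R : Rules N M) (S : Finset N) (hS : S.Nonempty) (p : N → ℚ)

theorem players_bracket :
    ((R.bracket S hS).map fun i => (i, p i)).players = (R.bracket S hS).leaves := by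
  simp [Bracket.players, Bracket.leaves_map, Function.comp_def]

theorem sum_leaves_bracket (g : N → ℚ) :
    ((R.bracket S hS).leaves.map g).sum = ∑ i ∈ S, g i := by
  rw [← List.sum_toFinset _ (R.nodup_leaves S hS)]
  congr 1
  ext i
  simp [R.mem_leaves S hS]

theorem total_bracket : ((R.bracket S hS).map fun i => (i, p i)).total = ∑ i ∈ S, p i := by
  rw [Bracket.total, Bracket.leaves_map, List.map_map, ← R.sum_leaves_bracket S hS]
  rfl

theorem weight_bracket (i : N) : ((R.bracket S hS).map fun i => (i, p i)).weight i =
    if i ∈ S then p i else 0 := by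
  rw [Bracket.weight, Bracket.leaves_map, List.map_map]
  simp only [Function.comp_def]
  rw [R.sum_leaves_bracket S hS]
  simp

end Rules

namespace State

variable {σ : Profile n N M} {C : Finset N} {st : State N M} {R : Rules N M}

theorem forest_eq_some {j : M} {B : Bracket (N × ℚ)} (hB : st.forest R j = some B) :
    j ∈ st.finished ∧ ∃ hc : (st.candidates j).Nonempty,
      B = (R.bracket (st.candidates j) hc).map fun i => (i, st.share i j) := by
  unfold forest at hB
  split_ifs at hB with h
  exact ⟨h.1, h.2, (Option.some_injective _ hB).symm⟩

theorem forest_eq_none {j : M} (hj : j ∉ st.finished) : st.forest R j = none :=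
  dif_neg fun h => hj h.1

theorem mem_players_forest {j : M} {B : Bracket (N × ℚ)} (hB : st.forest R j = some B) {i : N} :
    i ∈ B.players ↔ i ∈ st.candidates j := by
  obtain ⟨-, hc, rfl⟩ := forest_eq_some hB
  rw [R.players_bracket, R.mem_leaves]

namespace Invariant

variable (h : st.Invariant σ C)
include h

theorem exists_forest {j : M} (hj : j ∈ st.finished) : ∃ B, st.forest R j = some B :=
  ⟨_, dif_pos ⟨hj, h.candidates_nonempty hj⟩⟩

theorem total_forest {j : M} {B : Bracket (N × ℚ)} (hB : st.forest R j = some B) :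
    B.total = 1 := by
  obtain ⟨hj, hc, rfl⟩ := forest_eq_some hB
  rw [R.total_bracket, ← (mem_finished.1 hj).2]
  refine Finset.sum_subset (Finset.subset_univ _) fun k _ hk => ?_
  exact le_antisymm (not_lt.1 fun h' => hk (mem_candidates.2 h')) (h.share_nonneg k j)

theorem weight_forest {j : M} {B : Bracket (N × ℚ)} (hB : st.forest R j = some B) (i : N) :
    B.weight i = st.share i j := by
  obtain ⟨hj, hc, rfl⟩ := forest_eq_some hB
  rw [R.weight_bracket]
  split_ifs with hi
  · rfl
  · exact (le_antisymm (not_lt.1 fun h' => hi (mem_candidates.2 h')) (h.share_nonneg i j)).symm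

theorem depth_forest_le {j : M} {B : Bracket (N × ℚ)} (hB : st.forest R j = some B) :
    B.depth ≤ Fintype.card N := by
  obtain ⟨hj, hc, rfl⟩ := forest_eq_some hB
  refine (Bracket.depth_lt_length _).le.trans ?_
  rw [Bracket.leaves_map, List.length_map]
  exact (R.nodup_leaves _ hc).length_le_card

theorem proper_forest : (st.forest R).Proper where
  nodup j B hB := by
    obtain ⟨hj, hc, rfl⟩ := forest_eq_some hB
    rw [R.players_bracket]
    exact R.nodup_leaves _ hc
  pos j B hB := by
    obtain ⟨hj, hc, rfl⟩ := forest_eq_some hB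
    rw [Bracket.leaves_map]
    simp only [List.mem_map]
    rintro _ ⟨i, hi, rfl⟩
    exact mem_candidates.1 ((R.mem_leaves _ hc i).1 hi)
  disjoint j j' B B' hB hB' hjj x hx hx' := by
    rw [mem_players_forest hB] at hx
    rw [mem_players_forest hB'] at hx'
    exact hjj ((h.consumes_of_candidate (forest_eq_some hB).1 hx).unique
      (h.consumes_of_candidate (forest_eq_some hB').1 hx'))

theorem treeWeight_forest {j : M} (hj : j ∈ st.finished) (i : N) :
    treeWeight i (st.forest R j) = toENNReal (st.share i j) := by
  obtain ⟨B, hB⟩ := h.exists_forest (R := R) hj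
  rw [hB, treeWeight, Option.elim_some, h.weight_forest hB]

variable {adv : Adversary N} {f : ℕ} {past : List (Phase N)} {o : Outcome N M}
  (ho : o ∈ (playTournaments C adv (Fintype.card N) ⟨st.forest R, ∅, past⟩).support)
include ho

theorem exists_winner {j : M} (hj : j ∈ st.finished) : ∃ x ∈ st.candidates j,
    o.forest j = some (.leaf (x, 1)) ∧ o.winner j = some x := by
  obtain ⟨B, hB⟩ := h.exists_forest (R := R) hj
  obtain ⟨x, hx, hx'⟩ := (support_playTournaments ho h.proper_forest
    fun _ _ hB => h.depth_forest_le hB).2.1 j B hB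
  rw [h.total_forest hB] at hx'
  exact ⟨x, (mem_players_forest hB).1 hx, hx', by simp [Outcome.winner, hx', Bracket.champion]⟩

theorem notMem_caught_of_honest {i : N} (hi : i ∉ C) : i ∉ o.caught :=
  (support_playTournaments ho h.proper_forest fun _ _ hB => h.depth_forest_le hB).2.2 i hi
    (Finset.notMem_empty i)

end Invariant

theorem AtFinish.between_update (h : st.AtFinish σ C) {adv : Adversary N} {past : List (Phase N)}
    {o : Outcome N M}
    (ho : o ∈ (playTournaments C adv (Fintype.card N) ⟨st.forest R, ∅, past⟩).support) :
    (st.update o).Between σ C :=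
  h.update (fun _ hj => (h.exists_winner ho hj).imp fun _ hx => ⟨hx.1, hx.2.2⟩)
    fun _ hi => h.notMem_caught_of_honest ho hi

theorem AtFinish.card_remaining_update_lt (h : st.AtFinish σ C) (o : Outcome N M) :
    (st.update o).remaining.card < st.remaining.card := by
  refine Finset.card_lt_card ((Finset.ssubset_iff_of_subset Finset.sdiff_subset).2 ?_)
  obtain ⟨j, hj⟩ := h.finished_nonempty
  exact ⟨j, (mem_finished.1 hj).1, fun h' => (Finset.mem_sdiff.1 h').2 hj⟩

end State

/-! ## The main loop -/

section Run

variable {σ : Profile n N M} {C : Finset N} {R : Rules N M} {adv : Adversary N}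

theorem expect_run_succ {f : ℕ} {st : State N M} {past : List (Phase N)}
    (ha : ∃ i, 0 < st.rate i) (g : State N M → ℝ≥0∞) :
    (run R σ C adv (f + 1) st past).expect g =
      (playTournaments C adv (Fintype.card N) ⟨(st.consume σ).forest R, ∅, past⟩).expect fun o =>
        (run R σ C adv f ((st.consume σ).update o) o.past).expect g := by
  rw [run, if_pos ha, PMF.expect_bind]

/-- An invariant of the iterations of the main loop holds at the end. -/
theorem run_induction (hN : Fintype.card N = n) (hM : Fintype.card M = n)
    {P : State N M → Prop}
    (step : ∀ st past o, st.Between σ C → (st.consume σ).AtFinish σ C →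
      o ∈ (playTournaments C adv (Fintype.card N) ⟨(st.consume σ).forest R, ∅, past⟩).support →
      P st → P ((st.consume σ).update o)) {f : ℕ} :
    ∀ {st st' : State N M} {past : List (Phase N)}, st' ∈ (run R σ C adv f st past).support →
      st.Between σ C → P st → P st' ∧ st'.Between σ C := by
  induction f with
  | zero =>
    intro st st' past h hst hP
    simp only [run, PMF.support_pure, Set.mem_singleton_iff] at h
    exact h ▸ ⟨hP, hst⟩
  | succ f ih =>
    intro st st' past h hst hP
    rw [run] at h
    split_ifs at h with ha
    · obtain ⟨o, ho, h⟩ := (PMF.mem_support_bind_iff _ _ _).1 h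
      have hat := hst.atFinish hN hM ha
      exact ih h (hat.between_update ho) (step st past o hst hat ho hP)
    · simp only [PMF.support_pure, Set.mem_singleton_iff] at h
      exact h ▸ ⟨hP, hst⟩

theorem holder_run (hN : Fintype.card N = n) (hM : Fintype.card M = n) {f : ℕ}
    {st st' : State N M} {past : List (Phase N)} (h : st' ∈ (run R σ C adv f st past).support)
    (hst : st.Between σ C) {j : M} (hj : j ∉ st.remaining) : st'.holder j = st.holder j := by
  refine (run_induction hN hM (P := fun s => j ∉ s.remaining ∧ s.holder j = st.holder j) ?_ h hst
    ⟨hj, rfl⟩).1.2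
  rintro s past o - - - ⟨h1, h2⟩
  have h3 : j ∉ (s.consume σ).finished := fun h' => h1 (State.mem_finished.1 h').1
  refine ⟨fun h' => h1 (Finset.mem_sdiff.1 h').1, ?_⟩
  rw [State.holder_update, if_neg h3]
  exact h2

/-- Every iteration finishes an item, and by `card_alive_le` nobody is active when no item remains.
-/
theorem rate_run (hN : Fintype.card N = n) (hM : Fintype.card M = n) {f : ℕ} :
    ∀ {st st' : State N M} {past : List (Phase N)}, st' ∈ (run R σ C adv f st past).support →
      st.Between σ C → st.remaining.card ≤ f → ∀ i, st'.rate i = 0 := by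
  induction f with
  | zero =>
    intro st st' past h hst hf i
    simp only [run, PMF.support_pure, Set.mem_singleton_iff] at h
    subst h
    by_contra hr
    have h1 := hst.card_alive_le hN hM
    have h2 : 0 < (Finset.univ.filter fun i => 0 < st'.rate i).card := Finset.card_pos.2
      ⟨i, by simpa using lt_of_le_of_ne (hst.rate_nonneg i) (Ne.symm hr)⟩
    omega
  | succ f ih =>
    intro st st' past h hst hf
    rw [run] at h
    split_ifs at h with ha
    · obtain ⟨o, ho, h⟩ := (PMF.mem_support_bind_iff _ _ _).1 h
      have hat := hst.atFinish hN hM ha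
      have := hat.card_remaining_update_lt o
      refine ih h (hat.between_update ho) ?_
      change _ < st.remaining.card at this
      omega
    · simp only [PMF.support_pure, Set.mem_singleton_iff] at h
      subst h
      intro i
      exact le_antisymm (not_lt.1 fun h' => ha ⟨i, h'⟩) (hst.rate_nonneg i)

/-- In the honest case, all items are assigned in tournaments. -/
theorem remaining_run_eq_empty (hN : Fintype.card N = n) (hM : Fintype.card M = n)
    {st : State N M} (h : st ∈ (run R σ ∅ adv (Fintype.card M) (State.init N M) []).support) :
    st.remaining = ∅ := by
  have hr := rate_run hN hM h (State.between_init hM) (Finset.card_le_univ _)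
  have hst := (run_induction hN hM (P := fun _ => True) (fun _ _ _ _ _ _ _ => trivial) h
    (State.between_init hM) trivial).2
  -- With nobody corrupted, rate `0` means holding an item. So all `n` players hold different items,
  -- and these are all items.
  choose q hq hq' using fun i => hst.holds i (Finset.notMem_empty i) (hr i)
  have hinj : Function.Injective q := fun i i' hii => by
    have h1 := hq' i
    rw [hii, hq' i'] at h1
    exact (Option.some_injective _ h1).symm
  have hsurj := ((Fintype.bijective_iff_injective_and_card q).2 ⟨hinj, hN.trans hM.symm⟩).2
  refine Finset.eq_empty_of_forall_notMem fun j hj => ?_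
  obtain ⟨i, rfl⟩ := hsurj j
  exact hq i hj

theorem between_run (hN : Fintype.card N = n) (hM : Fintype.card M = n) {f : ℕ} {st : State N M}
    (h : st ∈ (run R σ C adv f (State.init N M) []).support) : st.Between σ C :=
  (run_induction hN hM (P := fun _ => True) (fun _ _ _ _ _ _ _ => trivial) h
    (State.between_init hM) trivial).2

theorem complete_eq_iff (hN : Fintype.card N = n) (hM : Fintype.card M = n) {st : State N M}
    (h : st ∈ (run R σ ∅ adv (Fintype.card M) (State.init N M) []).support) (i : N) (j : M) :
    R.complete st.holder i = j ↔ st.holder j = some i := by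
  have hst := between_run hN hM h
  refine ⟨fun hj => ?_, R.complete_eq _ hst.holder_inj j i⟩
  obtain ⟨x, hx⟩ := hst.held j (by simp [remaining_run_eq_empty hN hM h])
  have := R.complete_eq _ hst.holder_inj j x hx
  rw [hx, (R.complete st.holder).injective (this.trans hj.symm)]

end Run

/-! ## Stability -/

theorem _root_.Dominates.symm_le {O : Fin n ≃ M} {A A' : N ≃ M} {i : N}
    (h : Dominates O (assignmentMatrix A' i) (assignmentMatrix A i)) :
    O.symm (A' i) ≤ O.symm (A i) := by
  -- At the rank of `A i` the partial sum for `A` has reached `1`.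
  have h1 := h (O.symm (A i))
  have h2 : (1 : ℝ) ≤ ∑ k ∈ Finset.Iic (O.symm (A i)), assignmentMatrix A i (O k) := by
    have := Finset.single_le_sum (f := fun k => assignmentMatrix A i (O k))
      (fun k _ => by unfold assignmentMatrix; split_ifs <;> norm_num)
      (Finset.mem_Iic.2 (le_refl (O.symm (A i))))
    simpa [assignmentMatrix] using this
  obtain ⟨k, hk, hk'⟩ := Finset.exists_ne_zero_of_sum_ne_zero
    (zero_lt_one.trans_le (h2.trans h1)).ne'
  have : A' i = O k := by
    by_contra hne
    simp [assignmentMatrix, hne] at hk'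
  rw [this, Equiv.symm_apply_apply]
  exact Finset.mem_Iic.1 hk

theorem mechanism_stable (hN : Fintype.card N = n) (hM : Fintype.card M = n) (R : Rules N M) :
    (mechanism R : Mechanism n N M).Stable := by
  rintro σ A hA ⟨A', hne, hdom⟩
  rw [mechanism, protocol, PMF.mem_support_map_iff] at hA
  obtain ⟨st', hst', rfl⟩ := hA
  have hbet := between_run hN hM hst'
  have hle := fun i => (hdom i).symm_le
  -- the two assignments agree on all items that have been assigned so far
  have key : ∀ f st past, st' ∈ (run R σ ∅ (Adversary.silent N) f st past).support →
      st.Between σ ∅ →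
      (∀ j ∉ st.remaining, ∀ i, st.holder j = some i → A' i = j) →
      ∀ j ∉ st'.remaining, ∀ i, st'.holder j = some i → A' i = j := by
    intro f
    induction f with
    | zero =>
      intro st past h _ hP
      simp only [run, PMF.support_pure, Set.mem_singleton_iff] at h
      exact h ▸ hP
    | succ f ih =>
      intro st past h hst hP
      rw [run] at h
      split_ifs at h with ha
      · obtain ⟨o, ho, h⟩ := (PMF.mem_support_bind_iff _ _ _).1 h
        have hat := hst.atFinish hN hM ha
        have hup := hat.between_update ho
        refine ih _ _ h hup fun j hj i hji => ?_
        have hfin := hbet.holder_inj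
        have hcomp := R.complete_eq _ hfin j i ((holder_run hN hM h hup hj).trans hji)
        rw [State.holder_update] at hji
        split_ifs at hji with hjf
        · obtain ⟨x, hx, -, hwx⟩ := hat.exists_winner ho hjf
          obtain rfl : x = i := Option.some_injective _ (hwx.symm.trans hji)
          have hc : st.Consumes σ x j := hat.consumes_of_candidate hjf hx
          have h1 := hle x
          rw [hcomp] at h1
          -- If `A' x` remains, it is no better for `x` than its favorite `j`, and by dominance no
          -- worse. Otherwise it already has a holder `y`, and `A' y = A' x` forces `y = x`,
          -- although a holder has rate `0`.
          by_cases hr : A' x ∈ st.remaining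
          · exact (σ x).symm.injective (le_antisymm h1 (hc.2.2 _ hr))
          · obtain ⟨y, hy⟩ := hst.held _ hr
            have hyx : y = x := A'.injective (hP _ hr y hy)
            subst hyx
            exact absurd (hst.rate_holder _ _ hy) hc.1.ne'
        · exact hP j (fun h' => hj (Finset.mem_sdiff.2 ⟨h', hjf⟩)) i hji
      · simp only [PMF.support_pure, Set.mem_singleton_iff] at h
        exact h ▸ hP
  have hagree := key _ _ _ hst' (State.between_init hM) (by simp [State.init])
  have hempty := remaining_run_eq_empty hN hM hst'
  refine hne (Equiv.ext fun i => ?_)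
  exact hagree _ (by simp [hempty]) i ((complete_eq_iff hN hM hst' i _).1 rfl)

/-! ## Uniform dominance -/

section Dominance

variable {σ : Profile n N M} {C : Finset N} {R : Rules N M} {adv : Adversary N}

theorem _root_.inducedMatrix_eq_expect (ρ : PMF (N ≃ M)) (i : N) (j : M) :
    inducedMatrix ρ i j = (ρ.expect fun A => if A i = j then 1 else 0).toReal := by
  rw [PMF.expect_fintype, ENNReal.toReal_sum]
  · refine Finset.sum_congr rfl fun A _ => ?_
    unfold assignmentMatrix
    split_ifs <;> simp
  · intro A _
    split_ifs <;> simp [PMF.apply_ne_top]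

/-- An honest player loses the tournament for an item with probability at most the fraction of
the item that it has not consumed. -/
theorem expect_lose_le {st : State N M} (h : st.Invariant σ C) {past : List (Phase N)} {i : N}
    (hi : i ∉ C) {j : M} (hj : j ∈ st.finished) :
    ((playTournaments C adv (Fintype.card N) ⟨st.forest R, ∅, past⟩).expect fun o =>
      if o.winner j = some i then 0 else 1) ≤ toENNReal (1 - st.share i j) := by
  have h1 := treeWeight_le_expect (adv := adv) (f := Fintype.card N) hi j
    (o := ⟨st.forest R, ∅, past⟩) h.proper_forest
  simp only [h.treeWeight_forest hj] at h1
  -- The final tree is a leaf of weight `1`, so the weight of `i` in it is the indicator that `i`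
  -- wins.
  have h2 : ((playTournaments C adv (Fintype.card N) ⟨st.forest R, ∅, past⟩).expect fun o =>
      if o.winner j = some i then 0 else 1) +
      ((playTournaments C adv (Fintype.card N) ⟨st.forest R, ∅, past⟩).expect fun o =>
        treeWeight i (o.forest j)) = 1 := by
    rw [← PMF.expect_add]
    refine Eq.trans (PMF.expect_congr fun o ho => ?_) (PMF.expect_const _ 1)
    obtain ⟨x, -, hx, hw⟩ := h.exists_winner ho hj
    rw [hx, hw]
    rcases eq_or_ne x i with rfl | hxi
    · simp [treeWeight]
    · simp [treeWeight, hxi]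
  have h3 : toENNReal (1 - st.share i j) + toENNReal (st.share i j) = 1 := by
    rw [← toENNReal_add (sub_nonneg.2 (h.share_le_one i (State.mem_finished.1 hj).1))
      (h.share_nonneg i j), sub_add_cancel, toENNReal_one]
  rw [← h2] at h3
  have h4 := toENNReal_ne_top (st.share i j)
  refine (ENNReal.add_le_add_iff_right h4).1 ?_
  rw [h3]
  gcongr

/-- While `i` keeps its current item, its rate and hence the bound do not change. When the item is
finished at time `t`, the loss probability `s (1 - t)` cancels against the new rate `1 / (1 - t)`.
Ranks start at `0`, so `l + 1` items are concerned. -/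
theorem expect_fail_le (hN : Fintype.card N = n) (hM : Fintype.card M = n) {i : N} (hi : i ∉ C)
    (l : Fin n) {f : ℕ} : ∀ {st : State N M} {past : List (Phase N)}, st.Between σ C →
    st.remaining.card ≤ f → 0 < st.rate i → (∃ k ≤ l, σ i k ∈ st.remaining) →
    ((run R σ C adv f st past).expect fun s =>
      if ∃ k ≤ l, s.holder (σ i k) = some i then 0 else 1) ≤
      toENNReal (st.rate i * (1 - (l + 1) / n)) := by
  induction f with
  | zero =>
    rintro st past - hf - ⟨k, -, hk⟩
    rw [Finset.card_eq_zero.1 (Nat.le_zero.1 hf)] at hk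
    simp at hk
  | succ f ih =>
    rintro st past hst hf hr ⟨k, hkl, hk⟩
    have hn : (0 : ℚ) < n := by exact_mod_cast (Nat.zero_le _).trans_lt l.2
    have hl : (0 : ℚ) ≤ 1 - (l + 1) / n := by
      rw [sub_nonneg, div_le_one hn]
      exact_mod_cast l.2
    rw [expect_run_succ ⟨i, hr⟩]
    have hat := hst.atFinish hN hM ⟨i, hr⟩
    have hcard : ∀ o, ((st.consume σ).update o).remaining.card ≤ f := fun o => by
      have := hat.card_remaining_update_lt o
      change _ < st.remaining.card at this
      omega
    obtain ⟨j, hj⟩ := hst.exists_consumes hN hM hr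
    have hjl : (σ i).symm j ≤ l := (hj.2.2 _ hk).trans (by simpa using hkl)
    have hjc : i ∈ (st.consume σ).candidates j :=
      State.mem_candidates.2 (hat.share_pos i j hj)
    by_cases hjf : j ∈ (st.consume σ).finished
    · have hbal := hat.balance_of_consumes (State.consumes_consume.2 hj)
      change st.rate i * _ = _ at hbal
      generalize hmid : st.consume σ = mid at *
      set c : ℚ := (1 - (l + 1) / n) / (1 - mid.time) with hc
      have hc0 : 0 ≤ c := div_nonneg hl (sub_nonneg.2 (hat.time_le_one
        (hat.consumes_of_candidate hjf hjc)))
      have hstep : ∀ o ∈ (playTournaments C adv (Fintype.card N)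
          ⟨mid.forest R, ∅, past⟩).support,
          ((run R σ C adv f (mid.update o) o.past).expect fun s =>
            if ∃ k ≤ l, s.holder (σ i k) = some i then 0 else 1) ≤
          toENNReal c * if o.winner j = some i then 0 else 1 := by
        intro o ho
        have hup := hat.between_update ho
        obtain ⟨x, hx, -, hwx⟩ := hat.exists_winner ho hjf
        by_cases hix : i = x
        · subst hix
          rw [if_pos hwx, mul_zero]
          refine (PMF.expect_mono (g := fun _ => 0) fun s hs => ?_).trans (PMF.expect_const _ 0).le
          rw [if_pos]
          refine ⟨(σ i).symm j, hjl, ?_⟩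
          have hjr : j ∉ (mid.update o).remaining := fun h' => (Finset.mem_sdiff.1 h').2 hjf
          rw [Equiv.apply_symm_apply, holder_run hN hM hs hup hjr, State.holder_update,
            if_pos hjf, hwx]
        · rw [if_neg (by rw [hwx]; exact fun h' => hix (Option.some_injective _ h').symm), mul_one]
          obtain ⟨ht, hr'⟩ := State.Invariant.rate_update_mul hat.toInvariant hjf hjc hx hwx hix
            (hat.notMem_caught_of_honest ho hi)
          have hr'' : (mid.update o).rate i = 1 / (1 - mid.time) := by
            rw [eq_div_iff ht.ne', hr']
          by_cases hrem : ∃ k ≤ l, σ i k ∈ (mid.update o).remaining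
          · refine (ih hup (hcard o) (by rw [hr'']; positivity) hrem).trans (le_of_eq ?_)
            rw [hr'', hc, one_div_mul_eq_div]
          -- All `l + 1` top items are consumed, so `l + 1 ≤ n t` and `c` exceeds any probability.
          · have h1 : (1 : ℚ) ≤ c := by
              rw [hc, le_div_iff₀ ht, one_mul]
              have h2 := hup.consumed_le
              have h3 : 0 ≤ ∑ j ∈ (mid.update o).remaining, ∑ i, (mid.update o).share i j :=
                Finset.sum_nonneg fun j _ => Finset.sum_nonneg fun i _ => hup.share_nonneg i j
              have h4 : (mid.update o).remaining.card + (l + 1) ≤ n := by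
                have h5 : Disjoint (mid.update o).remaining ((Finset.Iic l).map (σ i).toEmbedding) := by
                  rw [Finset.disjoint_right]
                  intro j' hj'
                  obtain ⟨k', hk', rfl⟩ := Finset.mem_map.1 hj'
                  exact fun h' => hrem ⟨k', Finset.mem_Iic.1 hk', h'⟩
                have h6 := Finset.card_le_univ
                  ((mid.update o).remaining ∪ ((Finset.Iic l).map (σ i).toEmbedding))
                rwa [Finset.card_union_of_disjoint h5, Finset.card_map, Fin.card_Iic, hM] at h6
              have h4' : ((mid.update o).remaining.card : ℚ) + (l + 1) ≤ n := by exact_mod_cast h4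
              change _ ≤ n * mid.time at h2
              have : ((l : ℚ) + 1) / n ≤ mid.time := by
                rw [div_le_iff₀ hn]; linarith
              linarith
            calc _ ≤ (run R σ C adv f (mid.update o) o.past).expect fun _ => 1 :=
                  PMF.expect_mono fun s _ => by split_ifs <;> simp
              _ = 1 := PMF.expect_const _ _
              _ ≤ toENNReal c := by rw [← toENNReal_one]; exact toENNReal_mono h1
      refine (PMF.expect_mono hstep).trans ?_
      rw [PMF.expect_const_mul]
      calc _ ≤ toENNReal c * toENNReal (1 - mid.share i j) := by
            gcongr; exact expect_lose_le hat.toInvariant hi hjf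
        _ = toENNReal (c * (1 - mid.share i j)) := (toENNReal_mul hc0).symm
        _ ≤ _ := by
          apply toENNReal_mono
          rw [← hbal, hc]
          rcases eq_or_ne (1 - mid.time) 0 with h0 | h0
          · rw [h0]; simp only [mul_zero]; positivity
          · apply le_of_eq; field_simp
    · have hnc : ∀ j' ∈ (st.consume σ).finished, i ∉ (st.consume σ).candidates j' := by
        intro j' hj' hi'
        have := (hat.consumes_of_candidate hj' hi').unique (State.consumes_consume.2 hj)
        exact hjf (this ▸ hj')
      rw [← PMF.expect_const (playTournaments C adv (Fintype.card N)
        ⟨(st.consume σ).forest R, ∅, past⟩) (toENNReal _)]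
      refine PMF.expect_mono fun o ho => ?_
      have hrate : ((st.consume σ).update o).rate i = st.rate i :=
        State.rate_update_of_not_candidate hnc
      have := ih (past := o.past) (hat.between_update ho) (hcard o) (hrate ▸ hr)
        ⟨(σ i).symm j, hjl, by
          rw [Equiv.apply_symm_apply]; exact Finset.mem_sdiff.2 ⟨hj.2.1, hjf⟩⟩
      rwa [hrate] at this

theorem protocol_uniformDominance (hN : Fintype.card N = n) (hM : Fintype.card M = n)
    (R : Rules N M) : UniformDominance (n := n) (protocol R) := by
  intro σ C _ adv i hi l
  set p := run R σ C adv (Fintype.card M) (State.init N M) [] with hp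
  have h1 := expect_fail_le (R := R) (adv := adv) (past := []) hN hM hi l
    (State.between_init (σ := σ) (C := C) hM) (Finset.card_le_univ _) zero_lt_one
    ⟨l, le_rfl, Finset.mem_univ _⟩
  rw [← hp] at h1
  have hn : (0 : ℝ) < n := by exact_mod_cast (Nat.zero_le _).trans_lt l.2
  have h2 : ∑ k ∈ Finset.Iic l, inducedMatrix (protocol R σ C adv) i (σ i k) =
      ((protocol R σ C adv).expect fun A =>
        ∑ k ∈ Finset.Iic l, if A i = σ i k then 1 else 0).toReal := by
    simp only [inducedMatrix_eq_expect]
    rw [PMF.expect_finsetSum, ENNReal.toReal_sum]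
    intro k _
    refine ne_top_of_le_ne_top ENNReal.one_ne_top ?_
    conv_rhs => rw [← PMF.expect_const (protocol R σ C adv) 1]
    exact PMF.expect_mono fun A _ => by split_ifs <;> simp
  -- In every outcome either `i` holds none of its top items before the completion, or the sum
  -- counts one. The additive form avoids truncated subtraction.
  have h3 : 1 ≤ toENNReal (1 - (l + 1) / n) + ((protocol R σ C adv).expect fun A =>
      ∑ k ∈ Finset.Iic l, if A i = σ i k then 1 else 0) := by
    rw [protocol, PMF.expect_map, ← hp]
    have h1' : (State.init N M).rate i * (1 - ((l : ℚ) + 1) / n) = 1 - (l + 1) / n := by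
      simp [State.init]
    rw [h1'] at h1
    refine le_trans ?_ (add_le_add_left h1 _)
    rw [← PMF.expect_add]
    refine (PMF.expect_const p 1).symm.trans_le (PMF.expect_mono fun s hs => ?_)
    split_ifs with hk
    · obtain ⟨k, hk, hk'⟩ := hk
      have := R.complete_eq _ (between_run hN hM hs).holder_inj _ _ hk'
      rw [zero_add]
      refine le_trans ?_ (Finset.single_le_sum (f := fun k =>
        if R.complete s.holder i = σ i k then (1 : ℝ≥0∞) else 0) (fun _ _ => zero_le)
        (Finset.mem_Iic.2 hk))
      simp [this]
    · exact le_self_add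
  have h4 : ((protocol R σ C adv).expect fun A =>
      ∑ k ∈ Finset.Iic l, if A i = σ i k then (1 : ℝ≥0∞) else 0) ≠ ⊤ := by
    refine ne_top_of_le_ne_top (ENNReal.natCast_ne_top (Finset.Iic l).card) ?_
    rw [← PMF.expect_const (protocol R σ C adv) ((Finset.Iic l).card : ℝ≥0∞)]
    refine PMF.expect_mono fun A _ => ?_
    rw [Finset.card_eq_sum_ones, Nat.cast_sum]
    exact Finset.sum_le_sum fun k _ => by split_ifs <;> simp
  rw [h2]
  have h5 := ENNReal.toReal_mono (ENNReal.add_ne_top.2 ⟨toENNReal_ne_top _, h4⟩) h3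
  rw [ENNReal.toReal_add (toENNReal_ne_top _) h4] at h5
  have hl : (0 : ℝ) ≤ 1 - (l + 1) / n := by
    rw [sub_nonneg, div_le_one hn]
    exact_mod_cast l.2
  have h6 : (toENNReal (1 - ((l : ℚ) + 1) / n)).toReal = 1 - (l + 1) / n := by
    rw [toENNReal, ENNReal.toReal_ofReal] <;> push_cast
    · rfl
    · exact hl
  rw [h6, ENNReal.toReal_one] at h5
  rw [Finset.sum_const, Fin.card_Iic, nsmul_eq_mul]
  push_cast
  rw [mul_one_div]
  linarith

end Dominance

end OnlinePSVar

namespace OnlinePSVar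

variable {n : ℕ} {N M : Type*} [Fintype N] [DecidableEq N] [Fintype M] [DecidableEq M]

/-! ## Strong equal treatment -/

/-- An outcome of the tournaments with the given winners in which nobody has been caught. -/
def Outcome.ofWinners (w : M → Option N) : Outcome N M where
  forest j := (w j).map fun i => .leaf (i, 1)
  caught := ∅
  past := []

@[simp] theorem Outcome.winner_ofWinners (w : M → Option N) : (ofWinners w).winner = w := by
  funext j
  cases h : w j <;> simp [winner, ofWinners, h, Bracket.champion]

/-! ### Exchanging the roles of players. -/

namespace State

/-- The state in which player `i` has the role of player `e i`. -/
def relabel (e : Equiv.Perm N) (st : State N M) : State N M where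
  time := st.time
  rate i := st.rate (e i)
  share i j := st.share (e i) j
  remaining := st.remaining
  holder j := (st.holder j).map e.symm

variable {σ : Profile n N M} {st : State N M}

/-- Trees and messages matter only through the winners and the caught players, so an honest outcome
can be replaced by `Outcome.ofWinners`. -/
theorem update_congr {o o' : Outcome N M} (hw : o.winner = o'.winner)
    (hc : ∀ i, i ∈ o.caught ↔ i ∈ o'.caught) : st.update o = st.update o' := by
  have h : ∀ j, (o.forest j).bind Bracket.champion = (o'.forest j).bind Bracket.champion :=
    congrFun hw
  simp only [update, h, hc]

theorem bonus_relabel (e : Equiv.Perm N) (j : M) (x : Option N) (i : N) :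
    (st.relabel e).bonus j (x.map e.symm) i = st.bonus j x (e i) := by
  cases x with
  | none => rfl
  | some x =>
    have : ∑ k ∈ ((st.relabel e).candidates j).erase (e.symm x), (st.relabel e).share k j =
        ∑ k ∈ (st.candidates j).erase x, st.share k j := by
      refine Finset.sum_nbij' e e.symm ?_ ?_ ?_ ?_ ?_ <;>
        simp +contextual [mem_candidates, relabel, Equiv.eq_symm_apply]
    simp only [Option.map_some, bonus, this]
    simp [relabel]

theorem update_relabel (e : Equiv.Perm N) (w : M → Option N) :
    (st.relabel e).update (.ofWinners fun j => (w j).map e.symm) =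
      (st.update (.ofWinners w)).relabel e := by
  have hf : (st.relabel e).finished = st.finished := by
    simp only [finished]
    refine Finset.filter_congr fun j _ => ?_
    rw [← Equiv.sum_comp e fun i => st.share i j]
    rfl
  have hcand : ∀ i j, i ∈ (st.relabel e).candidates j ↔ e i ∈ st.candidates j := fun i j => by
    simp [mem_candidates, relabel]
  have hrate : ∀ i, ((st.relabel e).update (.ofWinners fun j => (w j).map e.symm)).rate i =
      ((st.update (.ofWinners w)).relabel e).rate i := by
    intro i
    change _ = (st.update (.ofWinners w)).rate (e i)
    rw [rate_update, rate_update]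
    simp only [hf, hcand, Outcome.winner_ofWinners, bonus_relabel]
    have h1 : ∀ j, (w j).map e.symm = some i ↔ w j = some (e i) := fun j => by
      simp [Option.map_eq_some_iff, Equiv.symm_apply_eq]
    simp only [h1, Outcome.ofWinners, Finset.notMem_empty, or_false]
    rfl
  have hholder : ∀ j, ((st.relabel e).update (.ofWinners fun j => (w j).map e.symm)).holder j =
      ((st.update (.ofWinners w)).relabel e).holder j := by
    intro j
    change _ = ((st.update (.ofWinners w)).holder j).map e.symm
    rw [holder_update, holder_update, hf]
    simp only [Outcome.winner_ofWinners]
    split_ifs <;> rfl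
  have hrem : ((st.relabel e).update (.ofWinners fun j => (w j).map e.symm)).remaining =
      ((st.update (.ofWinners w)).relabel e).remaining := by
    change st.remaining \ (st.relabel e).finished = st.remaining \ st.finished
    rw [hf]
  have h1 := funext hrate
  have h2 := funext hholder
  revert h1 h2 hrem
  generalize hs : (st.relabel e).update (.ofWinners fun j => (w j).map e.symm) = s
  have ht : s.time = st.time := by rw [← hs]; rfl
  have hsh : s.share = fun i j => st.share (e i) j := by rw [← hs]; rfl
  intro hrem h1 h2
  obtain ⟨t, r, sh, re, ho⟩ := s
  simp only at hrem h1 h2 ht hsh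
  subst hrem h1 h2 ht hsh
  rfl

theorem consume_relabel {e : Equiv.Perm N}
    (h : ∀ i j, (st.relabel e).Consumes σ i j ↔ st.Consumes σ (e i) j) :
    (st.relabel e).consume σ = (st.consume σ).relabel e := by
  have hdem : ∀ j, (st.relabel e).demand σ j = st.demand σ j := fun j => by
    simp only [demand, Finset.sum_filter]
    rw [← Equiv.sum_comp e fun i => if st.Consumes σ i j then st.rate i else 0]
    simp only [h]
    rfl
  have hsum : ∀ j, ∑ i, (st.relabel e).share i j = ∑ i, st.share i j := fun j =>
    Equiv.sum_comp e fun i => st.share i j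
  have hdel : (st.relabel e).delay σ = st.delay σ := by
    simp only [delay, hdem, hsum]
  simp only [consume, hdel, h]
  rfl

/-- The probability that `x` is the result of the tournament for item `j`. -/
theorem Invariant.prizeWeight_forest {C : Finset N} {R : Rules N M} (h : st.Invariant σ C)
    (x : Option N) (j : M) : prizeWeight x (st.forest R j) =
      if j ∈ st.finished then x.elim 0 fun i => toENNReal (st.share i j)
      else x.elim 1 fun _ => 0 := by
  split_ifs with hj
  · cases x with
    | none =>
      obtain ⟨B, hB⟩ := h.exists_forest (R := R) hj
      simp [hB, prizeWeight]
    | some i => exact h.treeWeight_forest hj i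
  · rw [forest_eq_none hj]
    cases x <;> simp [prizeWeight, treeWeight]

end State

/-! ### The honest run as a Markov chain, and its symmetry. -/

section Honest

variable {σ : Profile n N M} {R : Rules N M}

theorem State.AtFinish.update_ofWinners {st : State N M} (h : st.AtFinish σ ∅) {w : M → Option N}
    (hw : ∏ j, prizeWeight (w j) (st.forest R j) ≠ 0) :
    (st.update (.ofWinners w)).Between σ ∅ := by
  refine h.update (fun j hj => ?_) fun i _ => Finset.notMem_empty i
  have h1 := Finset.prod_ne_zero_iff.1 hw j (Finset.mem_univ j)
  rw [h.prizeWeight_forest, if_pos hj] at h1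
  cases hx : w j with
  | none => simp [hx] at h1
  | some x =>
    refine ⟨x, State.mem_candidates.2 ?_, by simp [hx]⟩
    refine lt_of_le_of_ne (h.share_nonneg x j) fun h0 => h1 ?_
    simp [hx, ← h0]

/-- By `ih` the rest of the run forgets the messages, so a step depends on the outcome only through
the winners, whose joint law is given by `expect_winner`. As `past` is absent from the right-hand
side, this also drives the induction that removes it. -/
theorem expect_run_honest_succ_of_past (hN : Fintype.card N = n) (hM : Fintype.card M = n)
    {f : ℕ} {g : State N M → ℝ≥0∞}
    (ih : ∀ (st : State N M) past, st.Between σ ∅ →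
      (run R σ ∅ (Adversary.silent N) f st past).expect g =
      (run R σ ∅ (Adversary.silent N) f st []).expect g)
    {st : State N M} (hst : st.Between σ ∅) (ha : ∃ i, 0 < st.rate i) (past : List (Phase N)) :
    (run R σ ∅ (Adversary.silent N) (f + 1) st past).expect g =
      ∑ w : M → Option N, (∏ j, prizeWeight (w j) ((st.consume σ).forest R j)) *
        (run R σ ∅ (Adversary.silent N) f ((st.consume σ).update (.ofWinners w)) []).expect g := by
  have hat := hst.atFinish hN hM ha
  rw [expect_run_succ ha, ← expect_winner (f := Fintype.card N)
    (o := ⟨(st.consume σ).forest R, ∅, past⟩) hat.proper_forest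
    (fun j B hB => hat.depth_forest_le hB) (fun j B hB => hat.total_forest hB)
    fun w => (run R σ ∅ (Adversary.silent N) f ((st.consume σ).update (.ofWinners w)) []).expect g]
  refine PMF.expect_congr fun o ho => ?_
  rw [ih _ _ (hat.between_update ho), State.update_congr (o' := .ofWinners o.winner)
    (Outcome.winner_ofWinners _).symm fun i => ?_]
  simpa [Outcome.ofWinners] using hat.notMem_caught_of_honest ho (Finset.notMem_empty i)

theorem expect_run_honest_past (hN : Fintype.card N = n) (hM : Fintype.card M = n)
    (g : State N M → ℝ≥0∞) {f : ℕ} : ∀ (st : State N M) past, st.Between σ ∅ →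
      (run R σ ∅ (Adversary.silent N) f st past).expect g =
      (run R σ ∅ (Adversary.silent N) f st []).expect g := by
  induction f with
  | zero => intros; rfl
  | succ f ih =>
    intro st past hst
    by_cases ha : ∃ i, 0 < st.rate i
    · rw [expect_run_honest_succ_of_past hN hM ih hst ha,
        expect_run_honest_succ_of_past hN hM ih hst ha]
    · simp only [run, if_neg ha]

/-- In the honest case, the winners are drawn independently, and each candidate wins an item with
probability equal to the fraction of the item that it has consumed. -/
theorem expect_run_honest_succ (hN : Fintype.card N = n) (hM : Fintype.card M = n)
    {f : ℕ} {g : State N M → ℝ≥0∞} {st : State N M} (hst : st.Between σ ∅)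
    (ha : ∃ i, 0 < st.rate i) (past : List (Phase N)) :
    (run R σ ∅ (Adversary.silent N) (f + 1) st past).expect g =
      ∑ w : M → Option N, (∏ j, prizeWeight (w j) ((st.consume σ).forest R j)) *
        (run R σ ∅ (Adversary.silent N) f ((st.consume σ).update (.ofWinners w)) []).expect g :=
  expect_run_honest_succ_of_past hN hM (expect_run_honest_past hN hM g) hst ha past

/-- The favorite item in `s` has rank at most `k`, where both orders agree. An item that beats it
under `O'` has a smaller rank, hence the same rank under `O`. -/
theorem favorite_of_agree {O O' : Fin n ≃ M} {k : Fin n} (h : ∀ m ≤ k, O m = O' m)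
    {s : Finset M} (hk : O k ∈ s) {j : M} (hj : ∀ j' ∈ s, O.symm j ≤ O.symm j') :
    ∀ j' ∈ s, O'.symm j ≤ O'.symm j' := by
  intro j' hj'
  have h1 : O.symm j ≤ k := by simpa using hj _ hk
  have h2 : O'.symm j = O.symm j := by
    rw [Equiv.symm_apply_eq, ← h _ h1, Equiv.apply_symm_apply]
  rw [h2]
  by_contra! h3
  have h4 : O.symm j' = O'.symm j' := by
    rw [Equiv.symm_apply_eq, h _ (h3.le.trans h1), Equiv.apply_symm_apply]
  exact absurd (hj j' hj') (by rw [h4]; exact not_le.2 h3)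

theorem consumes_relabel_swap {i i' : N} {k : Fin n} (h : ∀ m ≤ k, σ i m = σ i' m)
    {st : State N M} (hk : σ i k ∈ st.remaining) (x : N) (j : M) :
    (st.relabel (Equiv.swap i i')).Consumes σ x j ↔ st.Consumes σ (Equiv.swap i i' x) j := by
  have h1 : ∀ j, (∀ j' ∈ st.remaining, (σ i).symm j ≤ (σ i).symm j') ↔
      ∀ j' ∈ st.remaining, (σ i').symm j ≤ (σ i').symm j' := fun j =>
    ⟨favorite_of_agree h hk, favorite_of_agree (fun m hm => (h m hm).symm) (h k le_rfl ▸ hk)⟩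
  refine and_congr Iff.rfl (and_congr Iff.rfl ?_)
  change (∀ j' ∈ st.remaining, (σ x).symm j ≤ (σ x).symm j') ↔ _
  rcases eq_or_ne x i with rfl | hxi
  · rw [Equiv.swap_apply_left]; exact h1 j
  · rcases eq_or_ne x i' with rfl | hxi'
    · rw [Equiv.swap_apply_right]; exact (h1 j).symm
    · rw [Equiv.swap_apply_of_ne_of_ne hxi hxi']

/-- While the item remains, exchanging `i` and `i'` among the winners is a probability-preserving
bijection between the transitions of the two runs; afterwards the holder is fixed. The invariants of
the relabelled state are carried along separately, because the preferences of `i` and `i'` may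
differ beyond rank `k`. -/
theorem expect_run_relabel (hN : Fintype.card N = n) (hM : Fintype.card M = n) {i i' : N}
    {k : Fin n} (h : ∀ m ≤ k, σ i m = σ i' m) {f : ℕ} : ∀ {st : State N M}, st.Between σ ∅ →
    (st.relabel (Equiv.swap i i')).Between σ ∅ →
    ((run R σ ∅ (Adversary.silent N) f st []).expect fun s =>
      if s.holder (σ i k) = some i then 1 else 0) =
    ((run R σ ∅ (Adversary.silent N) f (st.relabel (Equiv.swap i i')) []).expect fun s =>
      if s.holder (σ i k) = some i' then 1 else 0) := by
  have hhold : ∀ st : State N M, (st.relabel (Equiv.swap i i')).holder (σ i k) = some i' ↔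
      st.holder (σ i k) = some i := fun st => by
    simp [State.relabel, Option.map_eq_some_iff, Equiv.swap_apply_eq_iff]
  induction f with
  | zero =>
    intro st _ _
    simp only [run, PMF.expect_pure, hhold]
  | succ f ih =>
    intro st hst hst'
    by_cases hk : σ i k ∈ st.remaining
    swap
    · rw [PMF.expect_congr fun s hs => by rw [holder_run hN hM hs hst hk],
        PMF.expect_congr (p := run R σ ∅ (Adversary.silent N) (f + 1) (st.relabel _) [])
          fun s hs => by rw [holder_run hN hM hs hst' hk],
        PMF.expect_const, PMF.expect_const]
      simp only [hhold]
    have hcons := consumes_relabel_swap h hk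
    by_cases ha : ∃ i, 0 < st.rate i
    swap
    · have ha' : ¬ ∃ x, 0 < (st.relabel (Equiv.swap i i')).rate x :=
        fun ⟨x, hx⟩ => ha ⟨_, hx⟩
      simp only [run, if_neg ha, if_neg ha', PMF.expect_pure, hhold]
    have ha' : ∃ x, 0 < (st.relabel (Equiv.swap i i')).rate x := by
      obtain ⟨x, hx⟩ := ha
      exact ⟨Equiv.swap i i' x, by simpa [State.relabel] using hx⟩
    have hat := hst.atFinish hN hM ha
    have hat' := hst'.atFinish hN hM ha'
    rw [expect_run_honest_succ hN hM hst ha, expect_run_honest_succ hN hM hst' ha']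
    rw [State.consume_relabel hcons] at hat' ⊢
    have hf : ((st.consume σ).relabel (Equiv.swap i i')).finished = (st.consume σ).finished := by
      simp only [State.finished]
      refine Finset.filter_congr fun j _ => ?_
      rw [← Equiv.sum_comp (Equiv.swap i i') fun i => (st.consume σ).share i j]
      rfl
    refine Fintype.sum_equiv (Equiv.piCongrRight fun _ => (Equiv.swap i i').symm.optionCongr) _ _
      fun w => ?_
    have hprod : ∏ j, prizeWeight ((w j).map (Equiv.swap i i').symm)
        (((st.consume σ).relabel (Equiv.swap i i')).forest R j) =
        ∏ j, prizeWeight (w j) ((st.consume σ).forest R j) := by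
      refine Finset.prod_congr rfl fun j _ => ?_
      rw [hat.prizeWeight_forest, hat'.prizeWeight_forest, hf]
      cases w j <;> simp [State.relabel]
    change _ = (∏ j, prizeWeight ((w j).map (Equiv.swap i i').symm) _) *
      (run R σ ∅ (Adversary.silent N) f (((st.consume σ).relabel (Equiv.swap i i')).update
        (.ofWinners fun j => (w j).map (Equiv.swap i i').symm)) []).expect _
    by_cases h0 : ∏ j, prizeWeight (w j) ((st.consume σ).forest R j) = 0
    · rw [hprod, h0, zero_mul, zero_mul]
    · have hup := hat.update_ofWinners h0
      have hup' := hat'.update_ofWinners (hprod ▸ h0)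
      rw [State.update_relabel] at hup' ⊢
      rw [hprod, ih hup hup']

end Honest

theorem mechanism_strongEqualTreatment (hN : Fintype.card N = n) (hM : Fintype.card M = n)
    (R : Rules N M) : (mechanism R : Mechanism n N M).StrongEqualTreatment := by
  intro σ i i' l h k hk
  have hind : ∀ (x : N) (j : M), inducedMatrix (mechanism R σ) x j =
      ((run R σ ∅ (Adversary.silent N) (Fintype.card M) (State.init N M) []).expect fun s =>
        if s.holder j = some x then 1 else 0).toReal := by
    intro x j
    rw [inducedMatrix_eq_expect, mechanism, protocol, PMF.expect_map]
    congr 1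
    refine PMF.expect_congr fun s hs => ?_
    simp only [complete_eq_iff hN hM hs]
  -- The initial state is symmetric, so both expectations belong to the same run.
  have hinit : (State.init N M).relabel (Equiv.swap i i') = State.init N M := rfl
  have := expect_run_relabel (R := R) hN hM (fun m hm => h m (hm.trans hk)) (f := Fintype.card M)
    (State.between_init hM) (by rw [hinit]; exact State.between_init hM)
  rw [hind, hind, ← h k hk, this, hinit]

end OnlinePSVar

theorem theorem3 {n : ℕ} {N M : Type*} [Fintype N] [DecidableEq N] [Fintype M] [DecidableEq M]
    (hN : Fintype.card N = n) (hM : Fintype.card M = n) (R : OnlinePSVar.Rules N M) :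
    (OnlinePSVar.mechanism R : Mechanism n N M).Stable ∧
    (OnlinePSVar.mechanism R : Mechanism n N M).StrongEqualTreatment ∧
    UniformDominance (n := n) (OnlinePSVar.protocol R) :=
  ⟨OnlinePSVar.mechanism_stable hN hM R, OnlinePSVar.mechanism_strongEqualTreatment hN hM R,
    OnlinePSVar.protocol_uniformDominance hN hM R⟩
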